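/- **Proposition.** There is an equivalence of categories $$\mathcal{L}\mathrm{ens} \;\simeq\; \mathcal{I}\mathrm{dx}(\mathcal{C}\mathrm{at}, \mathbb{M}\mathrm{od}(\mathbb{S}\mathrm{Mult}))_{\mathrm n}$$ between the category of delta lenses and the category of normal lax double functors $\mathbb{L}\mathrm{o}(\mathcal B)\to \mathbb{M}\mathrm{od}(\mathbb{S}\mathrm{Mult})$, where $\mathcal B$ ranges over all small categories. The notions used are the following. * A *delta lens* $(f,\varphi)\colon\mathcal A\to\mathcal B$ between small categories is a functor $f\colon \mathcal A\to\mathcal B$ with a choice, for each $a\in\mathcal A$ and $u\colon fa\to b$ in $\mathcal B$, of a morphism $\varphi(a,u)\colon a\to a'$ such that $f\varphi(a,u)=u$, $\varphi(a,1_{fa})=1_a$ and $\varphi(a,v\circ u)=\varphi(a',v)\circ\varphi(a,u)$. A morphism $(h,k)\colon(f,\varphi)\to(g,\psi)$ in $\mathcal{L}\mathrm{ens}$ is a pair of functors with $kf=gh$ and $h\varphi(a,u)=\psi(ha,ku)$. * A *double category* has objects, tight morphisms, loose morphisms and cells; tight composition is strict, and loose composition is associative and unital up to specified coherent invertible cells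 whose tight sides are identities. A *lax double functor* preserves tight composition strictly and has comparison cells for loose units and loose composites; it is *normal* if its unit comparison cells are identities. * For a category $\mathcal B$, $\mathbb{L}\mathrm{o}(\mathcal B)$ is the strict double category whose objects and loose morphisms are the objects and morphisms of $\mathcal B$ and whose tight morphisms and cells are identities. * $\mathbb{S}\mathrm{Mult}$ is the double category whose objects are sets, whose tight morphisms are functions, and whose loose morphisms $A\to B$ are *split multivalued functions*: a set $X$ with functions $s\colon X\to A$, $t\colon X\to B$, $\sigma\colon A\to X$ such that $s\sigma=1_A$. A cell from $(s,X,t,\sigma)$ to $(s',X',t',\sigma')$ with tight sides $f\colon A\to A'$, $g\colon B\to B'$ is a function $\alpha\colon X\to X'$ with $s'\alpha=fs$, $t'\alpha=gt$, $\alpha\sigma=\sigma'f$. Loose morphisms compose by pullback, with $a\mapsto(\sigma a,\sigma' t\sigma a)$ as the section of the composite. * $\mathbb{M}\mathrm{od}(\mathbb{S}\mathrm{Mult})$ is the double category whose objects are loose monads in $\mathbb{S}\mathrm{Mult}$, whose tight morphisms are monad morphisms, whose loose morphisms are bimodules, and whose cells are the cells of $\mathbb{S}\mathrm{Mult}$ that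 commute with the actions. The composite of a bimodule $P$ from $M$ to $N$ with a bimodule $Q$ from $N$ to $K$ is the coequaliser of the two actions $P\odot N\odot Q\rightrightarrows P\odot Q$, and a monad, acting on itself by multiplication, is the identity loose morphism. * For a double category $\mathbb X$, an object of $\mathcal{I}\mathrm{dx}(\mathcal{C}\mathrm{at},\mathbb X)$ is a small category $\mathcal B$ with a lax double functor $F\colon\mathbb{L}\mathrm{o}(\mathcal B)\to\mathbb X$. A morphism $(\mathcal B,F)\to(\mathcal D,G)$ is a functor $k\colon\mathcal B\to\mathcal D$ with a tight transformation $F\Rightarrow G\circ\mathbb{L}\mathrm{o}(k)$, that is, tight morphisms $Fx\to Gkx$ and cells $Fu\to Gku$ over them, compatible with the comparison cells. $\mathcal{I}\mathrm{dx}(\mathcal{C}\mathrm{at},\mathbb X)_{\mathrm n}$ is its full subcategory on the normal lax double functors. -/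

import Mathlib

open CategoryTheory

universe u₁ v₁ u₂ v₂ u₃ v₃ u₄ v₄ u₅ v₅ u₆ v₆ u

/-! ## Double categories

Tight composition is strict; loose composition is associative and unital up to specified
invertible globular cells. -/

/-- A (pseudo) double category. A `Cell f g p q` is a cell with loose source `p`, loose target `q`
and tight sides `f` (left) and `g` (right).

Cells compose in the tight direction strictly. The composite of `α : Cell f g p q` and
`β : Cell f' g' q r` is a cell with sides `f ≫ f'` and `g ≫ g'`; the arguments
`f ≫ f' = f''` and `g ≫ g' = g''` of `cellComp` only allow these sides to be written in another
way, so that the strict laws can be stated without transports. -/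
structure DoubleCategory where
  /-- objects -/
  Obj : Type u₁
  /-- tight morphisms -/
  [tight : Category.{v₁} Obj]
  /-- loose morphisms -/
  Loose : Obj → Obj → Type u₂
  /-- cells -/
  Cell : ∀ {A B C D : Obj}, (A ⟶ C) → (B ⟶ D) → Loose A B → Loose C D → Type v₂
  /-- identity cell on a loose morphism -/
  cellId : ∀ {A B : Obj} (p : Loose A B), Cell (𝟙 A) (𝟙 B) p p
  /-- composition of cells in the tight direction -/
  cellComp : ∀ {A B C D E F : Obj} {p : Loose A B} {q : Loose C D} {r : Loose E F}
    {f : A ⟶ C} {g : B ⟶ D} {f' : C ⟶ E} {g' : D ⟶ F} {f'' : A ⟶ E} {g'' : B ⟶ F},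
    Cell f g p q → Cell f' g' q r → f ≫ f' = f'' → g ≫ g' = g'' → Cell f'' g'' p r
  cell_id_comp : ∀ {A B C D : Obj} {p : Loose A B} {q : Loose C D} {f : A ⟶ C} {g : B ⟶ D}
    (α : Cell f g p q),
    cellComp (cellId p) α (Category.id_comp f) (Category.id_comp g) = α
  cell_comp_id : ∀ {A B C D : Obj} {p : Loose A B} {q : Loose C D} {f : A ⟶ C} {g : B ⟶ D}
    (α : Cell f g p q),
    cellComp α (cellId q) (Category.comp_id f) (Category.comp_id g) = α
  cell_assoc : ∀ {A₁ B₁ A₂ B₂ A₃ B₃ A₄ B₄ : Obj}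
    {p₁ : Loose A₁ B₁} {p₂ : Loose A₂ B₂} {p₃ : Loose A₃ B₃} {p₄ : Loose A₄ B₄}
    {f : A₁ ⟶ A₂} {g : B₁ ⟶ B₂} {f' : A₂ ⟶ A₃} {g' : B₂ ⟶ B₃} {f'' : A₃ ⟶ A₄} {g'' : B₃ ⟶ B₄}
    {a : A₁ ⟶ A₃} {b : B₁ ⟶ B₃} {a' : A₂ ⟶ A₄} {b' : B₂ ⟶ B₄} {c : A₁ ⟶ A₄} {d : B₁ ⟶ B₄}
    (α : Cell f g p₁ p₂) (β : Cell f' g' p₂ p₃) (γ : Cell f'' g'' p₃ p₄)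
    (e₁ : f ≫ f' = a) (e₂ : g ≫ g' = b) (e₃ : a ≫ f'' = c) (e₄ : b ≫ g'' = d)
    (e₅ : f' ≫ f'' = a') (e₆ : g' ≫ g'' = b') (e₇ : f ≫ a' = c) (e₈ : g ≫ b' = d),
    cellComp (cellComp α β e₁ e₂) γ e₃ e₄ = cellComp α (cellComp β γ e₅ e₆) e₇ e₈
  /-- identity loose morphism -/
  unit : ∀ A : Obj, Loose A A
  /-- identity cell on a tight morphism -/
  unitCell : ∀ {A B : Obj} (f : A ⟶ B), Cell f f (unit A) (unit B)
  unitCell_id : ∀ A : Obj, unitCell (𝟙 A) = cellId (unit A)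
  unitCell_comp : ∀ {A B C : Obj} (f : A ⟶ B) (g : B ⟶ C),
    unitCell (f ≫ g) = cellComp (unitCell f) (unitCell g) rfl rfl
  /-- composition of loose morphisms (in diagrammatic order) -/
  comp : ∀ {A B C : Obj}, Loose A B → Loose B C → Loose A C
  /-- composition of cells in the loose direction -/
  hcomp : ∀ {A B C A' B' C' : Obj} {f : A ⟶ A'} {g : B ⟶ B'} {h : C ⟶ C'}
    {p : Loose A B} {q : Loose B C} {p' : Loose A' B'} {q' : Loose B' C'},
    Cell f g p p' → Cell g h q q' → Cell f h (comp p q) (comp p' q')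
  hcomp_id : ∀ {A B C : Obj} (p : Loose A B) (q : Loose B C),
    hcomp (cellId p) (cellId q) = cellId (comp p q)
  /-- the interchange law -/
  hcomp_comp : ∀ {A B C A' B' C' A'' B'' C'' : Obj}
    {f : A ⟶ A'} {g : B ⟶ B'} {h : C ⟶ C'} {f' : A' ⟶ A''} {g' : B' ⟶ B''} {h' : C' ⟶ C''}
    {a : A ⟶ A''} {b : B ⟶ B''} {c : C ⟶ C''}
    {p : Loose A B} {q : Loose B C} {p' : Loose A' B'} {q' : Loose B' C'}
    {p'' : Loose A'' B''} {q'' : Loose B'' C''}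
    (α : Cell f g p p') (α' : Cell f' g' p' p'') (β : Cell g h q q') (β' : Cell g' h' q' q'')
    (e₁ : f ≫ f' = a) (e₂ : g ≫ g' = b) (e₃ : h ≫ h' = c),
    hcomp (cellComp α α' e₁ e₂) (cellComp β β' e₂ e₃) =
      cellComp (hcomp α β) (hcomp α' β') e₁ e₃
  /-- the associator and its inverse -/
  assoc : ∀ {A B C D : Obj} (p : Loose A B) (q : Loose B C) (r : Loose C D),
    Cell (𝟙 A) (𝟙 D) (comp (comp p q) r) (comp p (comp q r))
  assocInv : ∀ {A B C D : Obj} (p : Loose A B) (q : Loose B C) (r : Loose C D),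
    Cell (𝟙 A) (𝟙 D) (comp p (comp q r)) (comp (comp p q) r)
  assoc_inv : ∀ {A B C D : Obj} (p : Loose A B) (q : Loose B C) (r : Loose C D),
    cellComp (assoc p q r) (assocInv p q r) (Category.id_comp _) (Category.id_comp _) = cellId _
  inv_assoc : ∀ {A B C D : Obj} (p : Loose A B) (q : Loose B C) (r : Loose C D),
    cellComp (assocInv p q r) (assoc p q r) (Category.id_comp _) (Category.id_comp _) = cellId _
  assoc_naturality : ∀ {A B C D A' B' C' D' : Obj}
    {f : A ⟶ A'} {g : B ⟶ B'} {h : C ⟶ C'} {k : D ⟶ D'}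
    {p : Loose A B} {q : Loose B C} {r : Loose C D}
    {p' : Loose A' B'} {q' : Loose B' C'} {r' : Loose C' D'}
    (α : Cell f g p p') (β : Cell g h q q') (γ : Cell h k r r'),
    cellComp (hcomp (hcomp α β) γ) (assoc p' q' r') (Category.comp_id f) (Category.comp_id k) =
      cellComp (assoc p q r) (hcomp α (hcomp β γ)) (Category.id_comp f) (Category.id_comp k)
  /-- the left unitor and its inverse -/
  leftUnitor : ∀ {A B : Obj} (p : Loose A B), Cell (𝟙 A) (𝟙 B) (comp (unit A) p) p
  leftUnitorInv : ∀ {A B : Obj} (p : Loose A B), Cell (𝟙 A) (𝟙 B) p (comp (unit A) p)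
  leftUnitor_inv : ∀ {A B : Obj} (p : Loose A B),
    cellComp (leftUnitor p) (leftUnitorInv p) (Category.id_comp _) (Category.id_comp _) = cellId _
  inv_leftUnitor : ∀ {A B : Obj} (p : Loose A B),
    cellComp (leftUnitorInv p) (leftUnitor p) (Category.id_comp _) (Category.id_comp _) = cellId _
  leftUnitor_naturality : ∀ {A B C D : Obj} {p : Loose A B} {q : Loose C D}
    {f : A ⟶ C} {g : B ⟶ D} (α : Cell f g p q),
    cellComp (hcomp (unitCell f) α) (leftUnitor q) (Category.comp_id f) (Category.comp_id g) =
      cellComp (leftUnitor p) α (Category.id_comp f) (Category.id_comp g)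
  /-- the right unitor and its inverse -/
  rightUnitor : ∀ {A B : Obj} (p : Loose A B), Cell (𝟙 A) (𝟙 B) (comp p (unit B)) p
  rightUnitorInv : ∀ {A B : Obj} (p : Loose A B), Cell (𝟙 A) (𝟙 B) p (comp p (unit B))
  rightUnitor_inv : ∀ {A B : Obj} (p : Loose A B),
    cellComp (rightUnitor p) (rightUnitorInv p) (Category.id_comp _) (Category.id_comp _) =
      cellId _
  inv_rightUnitor : ∀ {A B : Obj} (p : Loose A B),
    cellComp (rightUnitorInv p) (rightUnitor p) (Category.id_comp _) (Category.id_comp _) =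
      cellId _
  rightUnitor_naturality : ∀ {A B C D : Obj} {p : Loose A B} {q : Loose C D}
    {f : A ⟶ C} {g : B ⟶ D} (α : Cell f g p q),
    cellComp (hcomp α (unitCell g)) (rightUnitor q) (Category.comp_id f) (Category.comp_id g) =
      cellComp (rightUnitor p) α (Category.id_comp f) (Category.id_comp g)
  pentagon : ∀ {A B C D E : Obj} (p : Loose A B) (q : Loose B C) (r : Loose C D) (s : Loose D E),
    cellComp (assoc (comp p q) r s) (assoc p q (comp r s))
        (Category.id_comp (𝟙 A)) (Category.id_comp (𝟙 E)) =
      cellComp (hcomp (assoc p q r) (cellId s))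
        (cellComp (assoc p (comp q r) s) (hcomp (cellId p) (assoc q r s))
          (Category.id_comp (𝟙 A)) (Category.id_comp (𝟙 E)))
        (Category.id_comp (𝟙 A)) (Category.id_comp (𝟙 E))
  triangle : ∀ {A B C : Obj} (p : Loose A B) (q : Loose B C),
    cellComp (assoc p (unit B) q) (hcomp (cellId p) (leftUnitor q))
        (Category.id_comp (𝟙 A)) (Category.id_comp (𝟙 C)) =
      hcomp (rightUnitor p) (cellId q)

attribute [instance] DoubleCategory.tight

namespace DoubleCategory

/-- A globular cell: both tight sides are identities. -/
abbrev Glob (X : DoubleCategory.{u₁, v₁, u₂, v₂}) {A B : X.Obj} (p q : X.Loose A B) : Type v₂ :=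
  X.Cell (𝟙 A) (𝟙 B) p q

/-- Tight composition of globular cells. -/
abbrev globComp (X : DoubleCategory.{u₁, v₁, u₂, v₂}) {A B : X.Obj} {p q r : X.Loose A B}
    (α : X.Glob p q) (β : X.Glob q r) : X.Glob p r :=
  X.cellComp α β (Category.id_comp _) (Category.id_comp _)

end DoubleCategory

/-! ## Lax double functors and tight transformations -/

/-- A lax double functor: functorial on tight morphisms and on cells under tight composition, with
globular comparison cells for loose units and loose composites. -/
@[ext]
structure LaxDoubleFunctor (X : DoubleCategory.{u₁, v₁, u₂, v₂})
    (Y : DoubleCategory.{u₃, v₃, u₄, v₄}) where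
  /-- action on objects and tight morphisms -/
  tight : X.Obj ⥤ Y.Obj
  /-- action on loose morphisms -/
  loose : ∀ {A B : X.Obj}, X.Loose A B → Y.Loose (tight.obj A) (tight.obj B)
  /-- action on cells -/
  cell : ∀ {A B C D : X.Obj} {f : A ⟶ C} {g : B ⟶ D} {p : X.Loose A B} {q : X.Loose C D},
    X.Cell f g p q → Y.Cell (tight.map f) (tight.map g) (loose p) (loose q)
  /-- preservation of identity cells (the composite with an identity cell only rewrites the sides
  `tight.map (𝟙 A)`, `tight.map (𝟙 B)` of `cell (cellId p)` as `𝟙 _`, `𝟙 _`) -/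
  cell_id : ∀ {A B : X.Obj} (p : X.Loose A B),
    Y.cellComp (cell (X.cellId p)) (Y.cellId (loose p)) (by simp) (by simp) = Y.cellId (loose p)
  cell_comp : ∀ {A B C D E F : X.Obj} {p : X.Loose A B} {q : X.Loose C D} {r : X.Loose E F}
    {f : A ⟶ C} {g : B ⟶ D} {f' : C ⟶ E} {g' : D ⟶ F} {f'' : A ⟶ E} {g'' : B ⟶ F}
    (α : X.Cell f g p q) (β : X.Cell f' g' q r) (e₁ : f ≫ f' = f'') (e₂ : g ≫ g' = g''),
    cell (X.cellComp α β e₁ e₂) =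
      Y.cellComp (cell α) (cell β) (by rw [← e₁, tight.map_comp]) (by rw [← e₂, tight.map_comp])
  /-- unit comparison -/
  unit : ∀ A : X.Obj, Y.Glob (Y.unit (tight.obj A)) (loose (X.unit A))
  /-- composition comparison -/
  mult : ∀ {A B C : X.Obj} (p : X.Loose A B) (q : X.Loose B C),
    Y.Glob (Y.comp (loose p) (loose q)) (loose (X.comp p q))
  unit_naturality : ∀ {A B : X.Obj} (f : A ⟶ B),
    Y.cellComp (unit A) (cell (X.unitCell f)) (Category.id_comp _) (Category.id_comp _) =
      Y.cellComp (Y.unitCell (tight.map f)) (unit B) (Category.comp_id _) (Category.comp_id _)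
  mult_naturality : ∀ {A B C A' B' C' : X.Obj} {f : A ⟶ A'} {g : B ⟶ B'} {h : C ⟶ C'}
    {p : X.Loose A B} {q : X.Loose B C} {p' : X.Loose A' B'} {q' : X.Loose B' C'}
    (α : X.Cell f g p p') (β : X.Cell g h q q'),
    Y.cellComp (mult p q) (cell (X.hcomp α β)) (Category.id_comp _) (Category.id_comp _) =
      Y.cellComp (Y.hcomp (cell α) (cell β)) (mult p' q') (Category.comp_id _) (Category.comp_id _)
  mult_assoc : ∀ {A B C D : X.Obj} (p : X.Loose A B) (q : X.Loose B C) (r : X.Loose C D),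
    Y.cellComp (Y.globComp (Y.hcomp (mult p q) (Y.cellId (loose r))) (mult (X.comp p q) r))
        (cell (X.assoc p q r)) (Category.id_comp _) (Category.id_comp _) =
      Y.cellComp (Y.globComp (Y.assoc (loose p) (loose q) (loose r))
          (Y.hcomp (Y.cellId (loose p)) (mult q r)))
        (mult p (X.comp q r)) (by simp) (by simp)
  unit_mult : ∀ {A B : X.Obj} (p : X.Loose A B),
    Y.cellComp (Y.globComp (Y.hcomp (unit A) (Y.cellId (loose p))) (mult (X.unit A) p))
        (cell (X.leftUnitor p)) (by simp) (by simp) = Y.leftUnitor (loose p)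
  mult_unit : ∀ {A B : X.Obj} (p : X.Loose A B),
    Y.cellComp (Y.globComp (Y.hcomp (Y.cellId (loose p)) (unit B)) (mult p (X.unit B)))
        (cell (X.rightUnitor p)) (by simp) (by simp) = Y.rightUnitor (loose p)

namespace DoubleCategory

/-- The objects of the category of loose morphisms and cells of a double category. -/
structure LooseOb (X : DoubleCategory.{u₁, v₁, u₂, v₂}) where
  {left right : X.Obj}
  loose : X.Loose left right

/-- A cell together with its two tight sides. -/
@[ext]
structure TotCell (X : DoubleCategory.{u₁, v₁, u₂, v₂}) (p q : LooseOb X) where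
  left : p.left ⟶ q.left
  right : p.right ⟶ q.right
  cell : X.Cell left right p.loose q.loose

variable {X : DoubleCategory.{u₁, v₁, u₂, v₂}}

/-- The category of loose morphisms and cells of a double category. -/
instance : Category (LooseOb X) where
  Hom p q := TotCell X p q
  id p := ⟨_, _, X.cellId p.loose⟩
  comp α β := ⟨_, _, X.cellComp α.cell β.cell rfl rfl⟩
  id_comp α := by
    obtain ⟨f, g, α⟩ := α
    have : ∀ (f' : _) (g' : _) (e₁ : 𝟙 _ ≫ f = f') (e₂ : 𝟙 _ ≫ g = g'),
        (⟨f', g', X.cellComp (X.cellId _) α e₁ e₂⟩ : TotCell X _ _) = ⟨f, g, α⟩ := by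
      intro f' g' e₁ e₂
      obtain rfl : f = f' := by simpa using e₁
      obtain rfl : g = g' := by simpa using e₂
      rw [X.cell_id_comp]
    exact this _ _ rfl rfl
  comp_id α := by
    obtain ⟨f, g, α⟩ := α
    have : ∀ (f' : _) (g' : _) (e₁ : f ≫ 𝟙 _ = f') (e₂ : g ≫ 𝟙 _ = g'),
        (⟨f', g', X.cellComp α (X.cellId _) e₁ e₂⟩ : TotCell X _ _) = ⟨f, g, α⟩ := by
      intro f' g' e₁ e₂
      obtain rfl : f = f' := by simpa using e₁
      obtain rfl : g = g' := by simpa using e₂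
      rw [X.cell_comp_id]
    exact this _ _ rfl rfl
  assoc α β γ := by
    obtain ⟨f, g, α⟩ := α
    obtain ⟨f', g', β⟩ := β
    obtain ⟨f'', g'', γ⟩ := γ
    have : ∀ (a : _) (b : _) (e₁ : f ≫ f' ≫ f'' = a) (e₂ : g ≫ g' ≫ g'' = b)
        (e₃ : (f ≫ f') ≫ f'' = a) (e₄ : (g ≫ g') ≫ g'' = b),
        (⟨a, b, X.cellComp (X.cellComp α β rfl rfl) γ e₃ e₄⟩ : TotCell X _ _) =
          ⟨_, _, X.cellComp α (X.cellComp β γ rfl rfl) rfl rfl⟩ := by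
      rintro a b rfl rfl e₃ e₄
      rw [X.cell_assoc]
    exact this _ _ (Category.assoc ..).symm (Category.assoc ..).symm rfl rfl

/-- A cell as a morphism of the category of loose morphisms and cells. -/
def tot {A B C D : X.Obj} {f : A ⟶ C} {g : B ⟶ D} {p : X.Loose A B} {q : X.Loose C D}
    (α : X.Cell f g p q) : LooseOb.mk p ⟶ LooseOb.mk q :=
  ⟨f, g, α⟩

lemma tot_injective {A B C D : X.Obj} {f : A ⟶ C} {g : B ⟶ D} {p : X.Loose A B}
    {q : X.Loose C D} {α β : X.Cell f g p q} (h : tot α = tot β) : α = β := by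
  injection h

lemma tot_id {A B : X.Obj} (p : X.Loose A B) : tot (X.cellId p) = 𝟙 (LooseOb.mk p) := rfl

lemma tot_comp {A B C D E F : X.Obj} {p : X.Loose A B} {q : X.Loose C D} {r : X.Loose E F}
    {f : A ⟶ C} {g : B ⟶ D} {f' : C ⟶ E} {g' : D ⟶ F} {f'' : A ⟶ E} {g'' : B ⟶ F}
    (α : X.Cell f g p q) (β : X.Cell f' g' q r) (e₁ : f ≫ f' = f'') (e₂ : g ≫ g' = g'') :
    tot (X.cellComp α β e₁ e₂) = tot α ≫ tot β := by
  subst e₁ e₂; rfl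

lemma tot_hcomp_congr {A B C A' B' C' : X.Obj}
    {f f₁ : A ⟶ A'} {g g₁ : B ⟶ B'} {h h₁ : C ⟶ C'}
    {p : X.Loose A B} {q : X.Loose B C} {p' : X.Loose A' B'} {q' : X.Loose B' C'}
    {α : X.Cell f g p p'} {β : X.Cell g h q q'} {α₁ : X.Cell f₁ g₁ p p'} {β₁ : X.Cell g₁ h₁ q q'}
    (hα : tot α = tot α₁) (hβ : tot β = tot β₁) :
    tot (X.hcomp α β) = tot (X.hcomp α₁ β₁) := by
  unfold tot at hα hβ
  injection hα with h₁ h₂ h₃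
  subst h₁ h₂
  injection hβ with _ h₄ h₅
  subst h₄
  rw [eq_of_heq h₃, eq_of_heq h₅]

end DoubleCategory

namespace LaxDoubleFunctor

open DoubleCategory

variable {X : DoubleCategory.{u₁, v₁, u₂, v₂}} {Y : DoubleCategory.{u₃, v₃, u₄, v₄}}
  {Z : DoubleCategory.{u₅, v₅, u₆, v₆}}

lemma tot_cell_id (F : LaxDoubleFunctor X Y) {A B : X.Obj} (p : X.Loose A B) :
    tot (F.cell (X.cellId p)) = 𝟙 _ := by
  have h := congrArg tot (F.cell_id p)
  rwa [tot_comp, tot_id, Category.comp_id] at h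

lemma tot_cell_congr (F : LaxDoubleFunctor X Y) {A B C D : X.Obj} {f f' : A ⟶ C} {g g' : B ⟶ D}
    {p : X.Loose A B} {q : X.Loose C D} {α : X.Cell f g p q} {β : X.Cell f' g' p q}
    (h : tot α = tot β) : tot (F.cell α) = tot (F.cell β) := by
  unfold tot at h
  injection h with h₁ h₂ h₃
  subst h₁ h₂
  rw [eq_of_heq h₃]

lemma tot_hcomp_comp {A B C A' B' C' A'' B'' C'' : X.Obj}
    {f : A ⟶ A'} {g : B ⟶ B'} {h : C ⟶ C'} {f' : A' ⟶ A''} {g' : B' ⟶ B''} {h' : C' ⟶ C''}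
    {a : A ⟶ A''} {b : B ⟶ B''} {c : C ⟶ C''}
    {p : X.Loose A B} {q : X.Loose B C} {p' : X.Loose A' B'} {q' : X.Loose B' C'}
    {p'' : X.Loose A'' B''} {q'' : X.Loose B'' C''}
    (α : X.Cell f g p p') (α' : X.Cell f' g' p' p'') (β : X.Cell g h q q')
    (β' : X.Cell g' h' q' q'') {γ : X.Cell a b p p''} {δ : X.Cell b c q q''}
    (hγ : tot γ = tot α ≫ tot α') (hδ : tot δ = tot β ≫ tot β') :
    tot (X.hcomp γ δ) = tot (X.hcomp α β) ≫ tot (X.hcomp α' β') := by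
  rw [← tot_comp _ _ rfl rfl, ← X.hcomp_comp α α' β β' rfl rfl rfl]
  exact tot_hcomp_congr (by rw [hγ, tot_comp]) (by rw [hδ, tot_comp])

/-- Composition of lax double functors. -/
abbrev comp (F : LaxDoubleFunctor X Y) (G : LaxDoubleFunctor Y Z) : LaxDoubleFunctor X Z where
  tight := F.tight ⋙ G.tight
  loose p := G.loose (F.loose p)
  cell α := G.cell (F.cell α)
  cell_id p := by
    apply tot_injective
    have h := congrArg (fun α => tot (G.cell α)) (F.cell_id p)
    simp only [tot_comp, tot_id, Category.comp_id, tot_cell_id, G.cell_comp] at h ⊢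
    exact h
  cell_comp α β e₁ e₂ := by rw [F.cell_comp, G.cell_comp]
  unit A := Z.cellComp (G.unit (F.tight.obj A)) (G.cell (F.unit A)) (by simp) (by simp)
  mult p q := Z.cellComp (G.mult (F.loose p) (F.loose q)) (G.cell (F.mult p q)) (by simp) (by simp)
  unit_naturality {A B} f := by
    apply tot_injective
    have h := congrArg (fun α => tot (G.cell α)) (F.unit_naturality f)
    have h' := congrArg tot (G.unit_naturality (F.tight.map f))
    simp only [tot_comp, G.cell_comp, Category.assoc] at h h' ⊢
    rw [h, reassoc_of% h']
    rfl
  mult_naturality α β := by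
    apply tot_injective
    have h := congrArg (fun α => tot (G.cell α)) (F.mult_naturality α β)
    have h' := congrArg tot (G.mult_naturality (F.cell α) (F.cell β))
    simp only [tot_comp, G.cell_comp, Category.assoc] at h h' ⊢
    rw [h, reassoc_of% h']
  mult_assoc p q r := by
    apply tot_injective
    have h := congrArg (fun α => tot (G.cell α)) (F.mult_assoc p q r)
    have h' := congrArg tot (G.mult_assoc (F.loose p) (F.loose q) (F.loose r))
    have h₁ := congrArg tot (G.mult_naturality (F.mult p q) (Y.cellId (F.loose r)))
    have h₂ := congrArg tot (G.mult_naturality (Y.cellId (F.loose p)) (F.mult q r))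
    simp only [tot_comp, G.cell_comp, Category.assoc] at h h' h₁ h₂ ⊢
    rw [tot_hcomp_comp (G.mult (F.loose p) (F.loose q)) (G.cell (F.mult p q))
        (Z.cellId (G.loose (F.loose r))) (G.cell (Y.cellId (F.loose r)))
        (by rw [tot_comp]) (by rw [tot_cell_id, Category.comp_id]),
      tot_hcomp_comp (Z.cellId (G.loose (F.loose p))) (G.cell (Y.cellId (F.loose p)))
        (G.mult (F.loose q) (F.loose r)) (G.cell (F.mult q r))
        (by rw [tot_cell_id, Category.comp_id]) (by rw [tot_comp]),
      Category.assoc, Category.assoc, ← reassoc_of% h₁, h, reassoc_of% h', reassoc_of% h₂]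
  unit_mult p := by
    apply tot_injective
    have h := congrArg (fun α => tot (G.cell α)) (F.unit_mult p)
    have h' := congrArg tot (G.unit_mult (F.loose p))
    have h₁ := congrArg tot (G.mult_naturality (F.unit _) (Y.cellId (F.loose p)))
    simp only [tot_comp, G.cell_comp, Category.assoc] at h h' h₁ ⊢
    rw [tot_hcomp_comp (G.unit _) (G.cell (F.unit _))
        (Z.cellId (G.loose (F.loose p))) (G.cell (Y.cellId (F.loose p)))
        (by rw [tot_comp]) (by rw [tot_cell_id, Category.comp_id]),
      Category.assoc, ← reassoc_of% h₁, h, h']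
  mult_unit p := by
    apply tot_injective
    have h := congrArg (fun α => tot (G.cell α)) (F.mult_unit p)
    have h' := congrArg tot (G.mult_unit (F.loose p))
    have h₁ := congrArg tot (G.mult_naturality (Y.cellId (F.loose p)) (F.unit _))
    simp only [tot_comp, G.cell_comp, Category.assoc] at h h' h₁ ⊢
    rw [tot_hcomp_comp (Z.cellId (G.loose (F.loose p))) (G.cell (Y.cellId (F.loose p)))
        (G.unit _) (G.cell (F.unit _))
        (by rw [tot_cell_id, Category.comp_id]) (by rw [tot_comp]),
      Category.assoc, ← reassoc_of% h₁, h, h']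

end LaxDoubleFunctor

/-- A tight transformation between lax double functors. -/
structure TightTrans {X : DoubleCategory.{u₁, v₁, u₂, v₂}} {Y : DoubleCategory.{u₃, v₃, u₄, v₄}}
    (F G : LaxDoubleFunctor X Y) where
  /-- the tight components -/
  app : F.tight ⟶ G.tight
  /-- the component cells at loose morphisms -/
  cell : ∀ {A B : X.Obj} (p : X.Loose A B), Y.Cell (app.app A) (app.app B) (F.loose p) (G.loose p)
  naturality : ∀ {A B C D : X.Obj} {f : A ⟶ C} {g : B ⟶ D} {p : X.Loose A B} {q : X.Loose C D}
    (α : X.Cell f g p q),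
    Y.cellComp (F.cell α) (cell q) (app.naturality f) (app.naturality g) =
      Y.cellComp (cell p) (G.cell α) rfl rfl
  unit : ∀ A : X.Obj,
    Y.cellComp (F.unit A) (cell (X.unit A)) (Category.id_comp _) (Category.id_comp _) =
      Y.cellComp (Y.unitCell (app.app A)) (G.unit A) (Category.comp_id _) (Category.comp_id _)
  mult : ∀ {A B C : X.Obj} (p : X.Loose A B) (q : X.Loose B C),
    Y.cellComp (F.mult p q) (cell (X.comp p q)) (Category.id_comp _) (Category.id_comp _) =
      Y.cellComp (Y.hcomp (cell p) (cell q)) (G.mult p q) (Category.comp_id _) (Category.comp_id _)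

/-- A lax double functor is normal if its unit comparison cells are identities. -/
def LaxDoubleFunctor.IsNormal {X : DoubleCategory.{u₁, v₁, u₂, v₂}}
    {Y : DoubleCategory.{u₃, v₃, u₄, v₄}} (F : LaxDoubleFunctor X Y) : Prop :=
  ∀ A : X.Obj, F.loose (X.unit A) = Y.unit (F.tight.obj A) ∧
    HEq (F.unit A) (Y.cellId (Y.unit (F.tight.obj A)))

/-! ## The strict double category `Lo(B)` of a category `B` -/

/-- The objects and loose morphisms of `Lo B` are the objects and morphisms of `B`; its only tight
morphisms and cells are identities. (A tight morphism of `Discrete B` is an equality of objects, and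
a cell is an equality of the two loose morphisms along such equalities.) -/
abbrev Lo (B : Type u) [Category.{u} B] : DoubleCategory.{u, u, u, 0} where
  Obj := Discrete B
  Loose x y := x.as ⟶ y.as
  Cell f g p q := PLift (p ≫ eqToHom (Discrete.eq_of_hom g) = eqToHom (Discrete.eq_of_hom f) ≫ q)
  cellId p := ⟨by simp⟩
  cellComp {_ _ _ _ _ _ p q r f g f' g' f'' g''} α β _ _ := ⟨by
    rw [← eqToHom_trans (Discrete.eq_of_hom g) (Discrete.eq_of_hom g'), reassoc_of% α.down,
      β.down, eqToHom_trans_assoc]⟩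
  cell_id_comp _ := rfl
  cell_comp_id _ := rfl
  cell_assoc _ _ _ _ _ _ _ _ _ _ _ := rfl
  unit x := 𝟙 x.as
  unitCell f := ⟨by simp⟩
  unitCell_id _ := rfl
  unitCell_comp _ _ := rfl
  comp p q := p ≫ q
  hcomp α β := ⟨by rw [Category.assoc, β.down, reassoc_of% α.down]⟩
  hcomp_id _ _ := rfl
  hcomp_comp _ _ _ _ _ _ _ := rfl
  assoc p q r := ⟨by simp⟩
  assocInv p q r := ⟨by simp⟩
  assoc_inv _ _ _ := rfl
  inv_assoc _ _ _ := rfl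
  assoc_naturality _ _ _ := rfl
  leftUnitor p := ⟨by simp⟩
  leftUnitorInv p := ⟨by simp⟩
  leftUnitor_inv _ := rfl
  inv_leftUnitor _ := rfl
  leftUnitor_naturality _ := rfl
  rightUnitor p := ⟨by simp⟩
  rightUnitorInv p := ⟨by simp⟩
  rightUnitor_inv _ := rfl
  inv_rightUnitor _ := rfl
  rightUnitor_naturality _ := rfl
  pentagon _ _ _ _ := rfl
  triangle _ _ := rfl

/-- The double functor `Lo k : Lo B ⥤ Lo D` of a functor `k : B ⥤ D`. -/
abbrev Lo.map {B D : Type u} [Category.{u} B] [Category.{u} D] (k : B ⥤ D) :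
    LaxDoubleFunctor (Lo B) (Lo D) where
  tight :=
    { obj := fun x => Discrete.mk (k.obj x.as)
      map := fun f => Discrete.eqToHom (congrArg k.obj (Discrete.eq_of_hom f)) }
  loose p := k.map p
  cell {_ _ _ _ f g p q} α := ⟨by
    have h := congrArg k.map α.down
    simpa only [Functor.map_comp, eqToHom_map] using h⟩
  cell_id _ := rfl
  cell_comp _ _ _ _ := rfl
  unit x := ⟨by simp⟩
  mult p q := ⟨by simp⟩
  unit_naturality _ := rfl
  mult_naturality _ _ := rfl
  mult_assoc _ _ _ := rfl
  unit_mult _ := rfl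
  mult_unit _ := rfl

/-! ## Indexed categories -/

namespace Lo

open DoubleCategory

lemma tot_eq {B : Type u} [Category.{u} B] {a b c d : Discrete B} {f f' : a ⟶ c} {g g' : b ⟶ d}
    {p : (Lo B).Loose a b} {q : (Lo B).Loose c d} (α : (Lo B).Cell f g p q)
    (β : (Lo B).Cell f' g' p q) : tot α = tot β := by
  obtain rfl : f = f' := Subsingleton.elim _ _
  obtain rfl : g = g' := Subsingleton.elim _ _
  exact congrArg tot (PLift.down_injective (Subsingleton.elim _ _))

lemma tot_cell_comp {B : Type u} [Category.{u} B] {X : DoubleCategory.{u₁, v₁, u₂, v₂}}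
    (F : LaxDoubleFunctor (Lo B) X) {a b a' b' a'' b'' : Discrete B}
    {f : a ⟶ a'} {g : b ⟶ b'} {f' : a' ⟶ a''} {g' : b' ⟶ b''} {f'' : a ⟶ a''} {g'' : b ⟶ b''}
    {p : (Lo B).Loose a b} {q : (Lo B).Loose a' b'} {r : (Lo B).Loose a'' b''}
    (α : (Lo B).Cell f g p q) (β : (Lo B).Cell f' g' q r) (γ : (Lo B).Cell f'' g'' p r) :
    tot (F.cell α) ≫ tot (F.cell β) = tot (F.cell γ) :=
  (tot_comp _ _ (F.tight.map_comp _ _).symm (F.tight.map_comp _ _).symm).symm.trans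
    ((congrArg tot (F.cell_comp α β rfl rfl).symm).trans (F.tot_cell_congr (tot_eq _ _)))

end Lo

open DoubleCategory in
lemma TightTrans.ext_tot {X : DoubleCategory.{u₁, v₁, u₂, v₂}}
    {Y : DoubleCategory.{u₃, v₃, u₄, v₄}} {F G : LaxDoubleFunctor X Y} {θ τ : TightTrans F G}
    (h : ∀ A, θ.app.app A = τ.app.app A)
    (h' : ∀ {A B : X.Obj} (p : X.Loose A B), tot (θ.cell p) = tot (τ.cell p)) : θ = τ := by
  obtain ⟨⟨θ, hθ⟩, θc, _, _, _⟩ := θ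
  obtain ⟨⟨τ, hτ⟩, τc, _, _, _⟩ := τ
  obtain rfl : θ = τ := funext h
  obtain rfl : @θc = @τc := by
    funext A B p
    exact tot_injective (h' p)
  rfl

/-- An object of `Idx(Cat, X)`: a small category `B` with a lax double functor `Lo B → X`. -/
structure Idx (X : DoubleCategory.{u₁, v₁, u₂, v₂}) where
  base : Cat.{u, u}
  fib : LaxDoubleFunctor (Lo base) X

namespace Idx

open DoubleCategory

variable {X : DoubleCategory.{u₁, v₁, u₂, v₂}}

/-- A morphism of `Idx(Cat, X)` from `(B, F)` to `(D, G)`: a functor `k : B ⥤ D` with a tight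
transformation from `F` to the composite of `Lo k` and `G`. -/
structure Hom (P Q : Idx.{u₁, v₁, u₂, v₂, u} X) where
  base : P.base ⥤ Q.base
  trans : TightTrans P.fib ((Lo.map base).comp Q.fib)

/-- The identity morphism, with identity components. -/
def Hom.id (P : Idx.{u₁, v₁, u₂, v₂, u} X) : Hom P P where
  base := 𝟭 _
  trans :=
    { app :=
        { app := fun A => 𝟙 (P.fib.tight.obj A)
          naturality := fun A B f =>
            (Category.comp_id _).trans (Eq.trans
              (congrArg P.fib.tight.map (Subsingleton.elim _ _)) (Category.id_comp _).symm) }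
      cell := fun p => X.cellId (P.fib.loose p)
      naturality := fun {A B C D f g p q} α => by
        apply tot_injective
        refine (tot_comp _ _ _ _).trans (Eq.trans ?_ (tot_comp _ _ _ _).symm)
        refine (Category.comp_id _).trans (Eq.trans ?_ (Category.id_comp _).symm)
        exact P.fib.tot_cell_congr (Lo.tot_eq _ _)
      unit := fun A => by
        apply tot_injective
        refine (tot_comp _ _ _ _).trans (Eq.trans ?_ (tot_comp _ _ _ _).symm)
        rw [X.unitCell_id]
        refine (Category.comp_id _).trans (Eq.trans ?_ (Category.id_comp _).symm)
        refine Eq.trans ?_ (tot_comp _ _ _ _).symm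
        refine (Category.comp_id _).symm.trans (congrArg (tot (P.fib.unit A) ≫ ·) ?_)
        exact ((P.fib.tot_cell_congr (Lo.tot_eq _ _)).trans (P.fib.tot_cell_id _)).symm
      mult := fun p q => by
        apply tot_injective
        refine (tot_comp _ _ _ _).trans (Eq.trans ?_ (tot_comp _ _ _ _).symm)
        rw [X.hcomp_id]
        refine (Category.comp_id _).trans (Eq.trans ?_ (Category.id_comp _).symm)
        refine Eq.trans ?_ (tot_comp _ _ _ _).symm
        refine (Category.comp_id _).symm.trans (congrArg (tot (P.fib.mult p q) ≫ ·) ?_)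
        exact ((P.fib.tot_cell_congr (Lo.tot_eq _ _)).trans (P.fib.tot_cell_id _)).symm }

/-- Composition of morphisms, with components `θ_x ≫ τ_{k x}`. -/
def Hom.comp {P Q R : Idx.{u₁, v₁, u₂, v₂, u} X} (α : Hom P Q) (β : Hom Q R) : Hom P R where
  base := α.base ⋙ β.base
  trans :=
    { app :=
        { app := fun A => α.trans.app.app A ≫ β.trans.app.app ⟨α.base.obj A.as⟩
          naturality := fun A B f => by
            have h₁ := α.trans.app.naturality f
            have h₂ := β.trans.app.naturality ((Lo.map α.base).tight.map f)
            refine (Category.assoc _ _ _).symm.trans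
              ((congrArg (· ≫ β.trans.app.app ⟨α.base.obj B.as⟩) h₁).trans ?_)
            refine (Category.assoc _ _ _).trans
              ((congrArg (α.trans.app.app A ≫ ·) h₂).trans ?_)
            refine Eq.trans ?_ (Category.assoc _ _ _).symm
            refine congrArg (fun t => α.trans.app.app A ≫ β.trans.app.app _ ≫ t) ?_
            exact congrArg R.fib.tight.map (Subsingleton.elim _ _) }
      cell := fun p => X.cellComp (α.trans.cell p) (β.trans.cell (α.base.map p)) rfl rfl
      naturality := fun {A B C D f g p q} γ => by
        apply tot_injective
        have h₁ := congrArg tot (α.trans.naturality γ)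
        have h₂ := congrArg tot (β.trans.naturality ((Lo.map α.base).cell γ))
        rw [tot_comp, tot_comp] at h₁ h₂
        rw [tot_comp, tot_comp, tot_comp, tot_comp, reassoc_of% h₁, Category.assoc]
        refine congrArg (tot (α.trans.cell p) ≫ ·) (h₂.trans ?_)
        exact congrArg (tot (β.trans.cell (α.base.map p)) ≫ ·)
          (R.fib.tot_cell_congr (Lo.tot_eq _ _))
      unit := fun ⟨a⟩ => by
        apply tot_injective
        have h₁ := congrArg tot (α.trans.unit ⟨a⟩)
        have h₂ := congrArg tot (β.trans.unit ⟨α.base.obj a⟩)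
        have h₃ := congrArg tot (β.trans.naturality ((Lo.map α.base).unit ⟨a⟩))
        simp only [tot_comp, X.unitCell_comp, Category.assoc] at h₁ h₂ h₃ ⊢
        rw [reassoc_of% h₁]
        refine congrArg (tot (X.unitCell (α.trans.app.app ⟨a⟩)) ≫ ·) ?_
        refine (congrArg (tot (Q.fib.unit ⟨α.base.obj a⟩) ≫ ·) h₃).trans ?_
        rw [reassoc_of% h₂]
        refine congrArg (fun t => tot (X.unitCell (β.trans.app.app ⟨α.base.obj a⟩)) ≫
          tot (R.fib.unit ⟨β.base.obj (α.base.obj a)⟩) ≫ t) ?_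
        exact Lo.tot_cell_comp R.fib _ _ _
      mult := fun p q => by
        apply tot_injective
        have h₁ := congrArg tot (α.trans.mult p q)
        have h₂ := congrArg tot (β.trans.mult (α.base.map p) (α.base.map q))
        have h₃ := congrArg tot (β.trans.naturality ((Lo.map α.base).mult p q))
        simp only [tot_comp, X.hcomp_comp, Category.assoc] at h₁ h₂ h₃ ⊢
        rw [reassoc_of% h₁]
        refine congrArg (tot (X.hcomp (α.trans.cell p) (α.trans.cell q)) ≫ ·) ?_
        refine (congrArg (tot (Q.fib.mult (α.base.map p) (α.base.map q)) ≫ ·) h₃).trans ?_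
        rw [reassoc_of% h₂]
        refine congrArg (fun t => tot (X.hcomp (β.trans.cell (α.base.map p))
          (β.trans.cell (α.base.map q))) ≫
          tot (R.fib.mult (β.base.map (α.base.map p)) (β.base.map (α.base.map q))) ≫ t) ?_
        exact Lo.tot_cell_comp R.fib _ _ _ }

instance : Category (Idx.{u₁, v₁, u₂, v₂, u} X) where
  Hom := Hom
  id := Hom.id
  comp := Hom.comp
  id_comp α := by
    refine congrArg (Hom.mk α.base) (TightTrans.ext_tot (fun A => Category.id_comp _) fun p => ?_)
    exact (tot_comp _ _ _ _).trans (Category.id_comp _)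
  comp_id α := by
    refine congrArg (Hom.mk α.base) (TightTrans.ext_tot (fun A => Category.comp_id _) fun p => ?_)
    exact (tot_comp _ _ _ _).trans (Category.comp_id _)
  assoc α β γ := by
    refine congrArg (Hom.mk (α.base ⋙ β.base ⋙ γ.base))
      (TightTrans.ext_tot (fun A => Category.assoc _ _ _) fun p => ?_)
    refine (tot_comp _ _ _ _).trans (Eq.trans ?_ (tot_comp _ _ _ _).symm)
    exact (congrArg (· ≫ _) (tot_comp _ _ _ _)).trans ((Category.assoc _ _ _).trans
      (congrArg (_ ≫ ·) (tot_comp _ _ _ _)).symm)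

end Idx

/-- The full subcategory of `Idx(Cat, X)` on the normal lax double functors. -/
abbrev NormalIdx (X : DoubleCategory.{u₁, v₁, u₂, v₂}) :=
  ObjectProperty.FullSubcategory fun P : Idx.{u₁, v₁, u₂, v₂, u} X => P.fib.IsNormal

/-! ## Split multivalued functions -/

/-- A split multivalued function `A ⇸ B`. -/
structure SplitMultFun (A B : Type u) where
  apex : Type u
  s : apex → A
  t : apex → B
  σ : A → apex
  s_σ : ∀ a, s (σ a) = a

namespace SplitMultFun

/-- A cell between split multivalued functions. -/
@[ext]
structure Cell {A B C D : Type u} (f : A ⟶ C) (g : B ⟶ D) (p : SplitMultFun A B)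
    (q : SplitMultFun C D) where
  map : p.apex → q.apex
  s_map : ∀ x, q.s (map x) = f (p.s x)
  t_map : ∀ x, q.t (map x) = g (p.t x)
  map_σ : ∀ a, map (p.σ a) = q.σ (f a)

/-- The identity split multivalued function. -/
abbrev unit (A : Type u) : SplitMultFun A A where
  apex := A
  s := id
  t := id
  σ := id
  s_σ _ := rfl

/-- The composite of split multivalued functions, whose apex is the pullback. -/
abbrev comp {A B C : Type u} (p : SplitMultFun A B) (q : SplitMultFun B C) : SplitMultFun A C where
  apex := {z : p.apex × q.apex // p.t z.1 = q.s z.2}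
  s z := p.s z.1.1
  t z := q.t z.1.2
  σ a := ⟨(p.σ a, q.σ (p.t (p.σ a))), (q.s_σ _).symm⟩
  s_σ a := p.s_σ a

end SplitMultFun

/-- The double category of sets, functions and split multivalued functions. -/
abbrev SMult : DoubleCategory.{u + 1, u, u + 1, u} where
  Obj := Type u
  Loose := SplitMultFun
  Cell := SplitMultFun.Cell
  cellId p := ⟨id, fun _ => rfl, fun _ => rfl, fun _ => rfl⟩
  cellComp α β e₁ e₂ :=
    { map := fun x => β.map (α.map x)
      s_map := fun x => by subst e₁; simp [β.s_map, α.s_map]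
      t_map := fun x => by subst e₂; simp [β.t_map, α.t_map]
      map_σ := fun a => by subst e₁; simp [β.map_σ, α.map_σ] }
  cell_id_comp _ := rfl
  cell_comp_id _ := rfl
  cell_assoc _ _ _ _ _ _ _ _ _ _ _ := rfl
  unit := SplitMultFun.unit
  unitCell f := ⟨f, fun _ => rfl, fun _ => rfl, fun _ => rfl⟩
  unitCell_id _ := rfl
  unitCell_comp _ _ := rfl
  comp := SplitMultFun.comp
  hcomp α β :=
    { map := fun z => ⟨(α.map z.1.1, β.map z.1.2), by rw [α.t_map, β.s_map, z.2]⟩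
      s_map := fun z => α.s_map z.1.1
      t_map := fun z => β.t_map z.1.2
      map_σ := fun a => Subtype.ext (Prod.ext (α.map_σ a)
        ((β.map_σ _).trans (by rw [← α.t_map, α.map_σ]))) }
  hcomp_id _ _ := rfl
  hcomp_comp _ _ _ _ _ _ _ := rfl
  assoc p q r :=
    { map := fun z => ⟨(z.1.1.1.1, ⟨(z.1.1.1.2, z.1.2), z.2⟩), z.1.1.2⟩
      s_map := fun _ => rfl
      t_map := fun _ => rfl
      map_σ := fun _ => rfl }
  assocInv p q r :=
    { map := fun z => ⟨(⟨(z.1.1, z.1.2.1.1), z.2⟩, z.1.2.1.2), z.1.2.2⟩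
      s_map := fun _ => rfl
      t_map := fun _ => rfl
      map_σ := fun _ => rfl }
  assoc_inv _ _ _ := rfl
  inv_assoc _ _ _ := rfl
  assoc_naturality _ _ _ := rfl
  leftUnitor p :=
    { map := fun z => z.1.2
      s_map := fun z => z.2.symm
      t_map := fun _ => rfl
      map_σ := fun _ => rfl }
  leftUnitorInv p :=
    { map := fun x => ⟨(p.s x, x), rfl⟩
      s_map := fun _ => rfl
      t_map := fun _ => rfl
      map_σ := fun a => Subtype.ext (Prod.ext (p.s_σ a) rfl) }
  leftUnitor_inv p := SplitMultFun.Cell.ext (funext fun z => Subtype.ext (Prod.ext z.2.symm rfl))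
  inv_leftUnitor _ := rfl
  leftUnitor_naturality _ := rfl
  rightUnitor p :=
    { map := fun z => z.1.1
      s_map := fun _ => rfl
      t_map := fun z => z.2
      map_σ := fun _ => rfl }
  rightUnitorInv p :=
    { map := fun x => ⟨(x, p.t x), rfl⟩
      s_map := fun _ => rfl
      t_map := fun _ => rfl
      map_σ := fun _ => rfl }
  rightUnitor_inv p := SplitMultFun.Cell.ext (funext fun z => Subtype.ext (Prod.ext rfl z.2))
  inv_rightUnitor _ := rfl
  rightUnitor_naturality _ := rfl
  pentagon _ _ _ _ := rfl
  triangle p q := SplitMultFun.Cell.ext (funext fun z => Subtype.ext (Prod.ext rfl (by simp)))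

/-! ## Monads and bimodules in a double category -/

/-- A loose monad in a double category. -/
structure LooseMonad (X : DoubleCategory.{u₁, v₁, u₂, v₂}) where
  obj : X.Obj
  loose : X.Loose obj obj
  mul : X.Glob (X.comp loose loose) loose
  one : X.Glob (X.unit obj) loose
  mul_assoc : X.globComp (X.hcomp mul (X.cellId loose)) mul =
    X.globComp (X.globComp (X.assoc loose loose loose) (X.hcomp (X.cellId loose) mul)) mul
  one_mul : X.globComp (X.hcomp one (X.cellId loose)) mul = X.leftUnitor loose
  mul_one : X.globComp (X.hcomp (X.cellId loose) one) mul = X.rightUnitor loose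

namespace LooseMonad

open DoubleCategory

variable {X : DoubleCategory.{u₁, v₁, u₂, v₂}}

/-- A tight morphism of loose monads. -/
@[ext]
structure Hom (M N : LooseMonad X) where
  tight : M.obj ⟶ N.obj
  cell : X.Cell tight tight M.loose N.loose
  map_mul : X.cellComp M.mul cell (Category.id_comp _) (Category.id_comp _) =
    X.cellComp (X.hcomp cell cell) N.mul (Category.comp_id _) (Category.comp_id _)
  map_one : X.cellComp M.one cell (Category.id_comp _) (Category.id_comp _) =
    X.cellComp (X.unitCell tight) N.one (Category.comp_id _) (Category.comp_id _)

/-- Composition of monad morphisms. -/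
abbrev Hom.comp {M N K : LooseMonad X} (f : Hom M N) (g : Hom N K) : Hom M K where
  tight := f.tight ≫ g.tight
  cell := X.cellComp f.cell g.cell rfl rfl
  map_mul := by
    apply tot_injective
    have h₁ := congrArg tot f.map_mul
    have h₂ := congrArg tot g.map_mul
    simp only [tot_comp, X.hcomp_comp, Category.assoc] at h₁ h₂ ⊢
    rw [reassoc_of% h₁, h₂]
  map_one := by
    apply tot_injective
    have h₁ := congrArg tot f.map_one
    have h₂ := congrArg tot g.map_one
    simp only [tot_comp, X.unitCell_comp, Category.assoc] at h₁ h₂ ⊢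
    rw [reassoc_of% h₁, h₂]

/-- The identity monad morphism. -/
abbrev Hom.id (M : LooseMonad X) : Hom M M where
  tight := 𝟙 _
  cell := X.cellId _
  map_mul := by rw [X.cell_comp_id, X.hcomp_id, X.cell_id_comp]
  map_one := by rw [X.cell_comp_id, X.unitCell_id, X.cell_id_comp]

lemma Hom.ext_tot {M N : LooseMonad X} {f g : Hom M N} (h : tot f.cell = tot g.cell) : f = g := by
  obtain ⟨f, α, _, _⟩ := f
  obtain ⟨g, β, _, _⟩ := g
  obtain rfl : f = g := congrArg TotCell.left h
  obtain rfl : α = β := tot_injective h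
  rfl

instance : Category (LooseMonad X) where
  Hom := Hom
  id := Hom.id
  comp := Hom.comp
  id_comp f := Hom.ext_tot ((tot_comp _ _ rfl rfl).trans (Category.id_comp _))
  comp_id f := Hom.ext_tot ((tot_comp _ _ rfl rfl).trans (Category.comp_id _))
  assoc f g h := Hom.ext_tot (by
    refine (tot_comp _ _ rfl rfl).trans (Eq.trans ?_ (tot_comp _ _ rfl rfl).symm)
    exact (congrArg (· ≫ _) (tot_comp _ _ rfl rfl)).trans ((Category.assoc _ _ _).trans
      (congrArg (_ ≫ ·) (tot_comp _ _ rfl rfl)).symm))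

end LooseMonad

/-- A bimodule from a loose monad `M` to a loose monad `N`. -/
structure Bimodule {X : DoubleCategory.{u₁, v₁, u₂, v₂}} (M N : LooseMonad X) where
  loose : X.Loose M.obj N.obj
  lact : X.Glob (X.comp M.loose loose) loose
  ract : X.Glob (X.comp loose N.loose) loose
  mul_lact : X.globComp (X.hcomp M.mul (X.cellId loose)) lact =
    X.globComp (X.globComp (X.assoc M.loose M.loose loose)
      (X.hcomp (X.cellId M.loose) lact)) lact
  one_lact : X.globComp (X.hcomp M.one (X.cellId loose)) lact = X.leftUnitor loose
  ract_mul : X.globComp (X.hcomp ract (X.cellId N.loose)) ract =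
    X.globComp (X.globComp (X.assoc loose N.loose N.loose)
      (X.hcomp (X.cellId loose) N.mul)) ract
  ract_one : X.globComp (X.hcomp (X.cellId loose) N.one) ract = X.rightUnitor loose
  lact_ract : X.globComp (X.hcomp lact (X.cellId N.loose)) ract =
    X.globComp (X.globComp (X.assoc M.loose loose N.loose)
      (X.hcomp (X.cellId M.loose) ract)) lact

namespace Bimodule

open DoubleCategory

variable {X : DoubleCategory.{u₁, v₁, u₂, v₂}}

/-- A cell between bimodules along monad morphisms: a cell of the double category that commutes
with the actions. -/
@[ext]
structure Cell {M N M' N' : LooseMonad X} (f : M ⟶ M') (g : N ⟶ N') (p : Bimodule M N)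
    (q : Bimodule M' N') where
  cell : X.Cell f.tight g.tight p.loose q.loose
  map_lact : X.cellComp p.lact cell (Category.id_comp _) (Category.id_comp _) =
    X.cellComp (X.hcomp f.cell cell) q.lact (Category.comp_id _) (Category.comp_id _)
  map_ract : X.cellComp p.ract cell (Category.id_comp _) (Category.id_comp _) =
    X.cellComp (X.hcomp cell g.cell) q.ract (Category.comp_id _) (Category.comp_id _)

/-- The identity cell on a bimodule. -/
abbrev Cell.id {M N : LooseMonad X} (p : Bimodule M N) : Cell (𝟙 M) (𝟙 N) p p where
  cell := X.cellId _
  map_lact := by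
    refine (X.cell_comp_id _).trans (Eq.symm ?_)
    exact (congrArg (fun α => X.cellComp α p.lact _ _) (X.hcomp_id _ _)).trans (X.cell_id_comp _)
  map_ract := by
    refine (X.cell_comp_id _).trans (Eq.symm ?_)
    exact (congrArg (fun α => X.cellComp α p.ract _ _) (X.hcomp_id _ _)).trans (X.cell_id_comp _)

/-- Tight composition of cells between bimodules. -/
abbrev Cell.comp {M N M' N' M'' N'' : LooseMonad X} {p : Bimodule M N} {q : Bimodule M' N'}
    {r : Bimodule M'' N''} {f : M ⟶ M'} {g : N ⟶ N'} {f' : M' ⟶ M''} {g' : N' ⟶ N''}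
    {f'' : M ⟶ M''} {g'' : N ⟶ N''} (α : Cell f g p q) (β : Cell f' g' q r)
    (e₁ : f ≫ f' = f'') (e₂ : g ≫ g' = g'') : Cell f'' g'' p r where
  cell := X.cellComp α.cell β.cell (congrArg LooseMonad.Hom.tight e₁)
    (congrArg LooseMonad.Hom.tight e₂)
  map_lact := by
    subst e₁ e₂
    apply tot_injective
    have h₁ := congrArg tot α.map_lact
    have h₂ := congrArg tot β.map_lact
    have h₃ := congrArg tot
      (X.hcomp_comp f.cell f'.cell α.cell β.cell rfl rfl rfl)
    simp only [tot_comp] at h₁ h₂ h₃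
    refine (tot_comp _ _ _ _).trans (Eq.trans ?_ (tot_comp _ _ _ _).symm)
    refine (congrArg (tot p.lact ≫ ·) (tot_comp _ _ _ _)).trans ?_
    rw [reassoc_of% h₁, h₂, ← Category.assoc, ← h₃]
    rfl
  map_ract := by
    subst e₁ e₂
    apply tot_injective
    have h₁ := congrArg tot α.map_ract
    have h₂ := congrArg tot β.map_ract
    have h₃ := congrArg tot
      (X.hcomp_comp α.cell β.cell g.cell g'.cell rfl rfl rfl)
    simp only [tot_comp] at h₁ h₂ h₃
    refine (tot_comp _ _ _ _).trans (Eq.trans ?_ (tot_comp _ _ _ _).symm)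
    refine (congrArg (tot p.ract ≫ ·) (tot_comp _ _ _ _)).trans ?_
    rw [reassoc_of% h₁, h₂, ← Category.assoc, ← h₃]
    rfl

/-- A loose monad as a bimodule over itself. -/
abbrev unit (M : LooseMonad X) : Bimodule M M where
  loose := M.loose
  lact := M.mul
  ract := M.mul
  mul_lact := M.mul_assoc
  one_lact := M.one_mul
  ract_mul := M.mul_assoc
  ract_one := M.mul_one
  lact_ract := M.mul_assoc

/-- A monad morphism as a cell between unit bimodules. -/
abbrev unitCell {M N : LooseMonad X} (f : M ⟶ N) : Cell f f (unit M) (unit N) where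
  cell := f.cell
  map_lact := f.map_mul
  map_ract := f.map_mul

end Bimodule

/-! ## Local coequalisers of split multivalued functions -/

namespace SplitMultFun

variable {A B C D : Type u}

/-- The coequaliser of a parallel pair of globular cells, computed on apices. -/
abbrev coeq {p q : SplitMultFun A B} (α β : Cell (𝟙 A) (𝟙 B) p q) : SplitMultFun A B where
  apex := Quot fun y y' => ∃ x, y = α.map x ∧ y' = β.map x
  s := Quot.lift q.s (by rintro _ _ ⟨x, rfl, rfl⟩; rw [α.s_map, β.s_map])
  t := Quot.lift q.t (by rintro _ _ ⟨x, rfl, rfl⟩; rw [α.t_map, β.t_map])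
  σ a := Quot.mk _ (q.σ a)
  s_σ := q.s_σ

/-- The projection to the coequaliser. -/
abbrev coeqProj {p q : SplitMultFun A B} (α β : Cell (𝟙 A) (𝟙 B) p q) :
    Cell (𝟙 A) (𝟙 B) q (coeq α β) where
  map := Quot.mk _
  s_map _ := rfl
  t_map _ := rfl
  map_σ _ := rfl

/-- The projection coequalises the pair, universally among cells with arbitrary tight sides. -/
theorem coeq_universal {p q : SplitMultFun A B} (α β : Cell (𝟙 A) (𝟙 B) p q) :
    (SMult.globComp α (coeqProj α β) = SMult.globComp β (coeqProj α β)) ∧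
    ∀ {A' B' : Type u} (f : A ⟶ A') (g : B ⟶ B') (r : SplitMultFun A' B') (γ : Cell f g q r),
      (∀ x, γ.map (α.map x) = γ.map (β.map x)) →
        ∃! δ : Cell f g (coeq α β) r, ∀ y, δ.map (Quot.mk _ y) = γ.map y := by
  refine ⟨Cell.ext (funext fun x => Quot.sound ⟨x, rfl, rfl⟩), fun f g r γ h => ?_⟩
  refine ⟨⟨Quot.lift γ.map (by rintro _ _ ⟨x, rfl, rfl⟩; exact h x), ?_, ?_, γ.map_σ⟩,
    fun _ => rfl, fun δ hδ => ?_⟩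
  · rintro ⟨y⟩; exact γ.s_map y
  · rintro ⟨y⟩; exact γ.t_map y
  · refine Cell.ext (funext ?_)
    rintro ⟨y⟩
    exact hδ y

/-- A function on a quotient that is only defined where `P` holds. -/
def quotLift {α : Sort*} {r : α → α → Prop} {P : Quot r → Prop} {β : Sort*}
    (f : ∀ a, P (Quot.mk r a) → β)
    (hf : ∀ a b (_ : r a b) (ha : P (Quot.mk r a)) (hb : P (Quot.mk r b)), f a ha = f b hb)
    (z : Quot r) : P z → β :=
  Quot.hrecOn (motive := fun z => P z → β) z f fun a b h =>
    Function.hfunext (congrArg P (Quot.sound h)) fun ha hb _ => heq_of_eq (hf a b h ha hb)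

/-- Loose composition preserves local coequalisers: a function out of `r ⊙ coeq α β` is a function
out of `r ⊙ q` that identifies the two images of `r ⊙ p`. -/
def liftRight {r : SplitMultFun A B} {p q : SplitMultFun B C} {α β : Cell (𝟙 B) (𝟙 C) p q}
    {γ : Sort*} (f : ∀ (x : r.apex) (y : q.apex), r.t x = q.s y → γ)
    (hf : ∀ x y h h', f x (α.map y) h = f x (β.map y) h') (z : (comp r (coeq α β)).apex) : γ :=
  quotLift (P := fun w => r.t z.1.1 = (coeq α β).s w) (fun y h => f z.1.1 y h)
    (by rintro _ _ ⟨y, rfl, rfl⟩ h h'; exact hf _ _ _ _) z.1.2 z.2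

/-- Loose composition preserves local coequalisers, on the other side. -/
def liftLeft {p q : SplitMultFun A B} {r : SplitMultFun B C} {α β : Cell (𝟙 A) (𝟙 B) p q}
    {γ : Sort*} (f : ∀ (y : q.apex) (x : r.apex), q.t y = r.s x → γ)
    (hf : ∀ y x h h', f (α.map y) x h = f (β.map y) x h') (z : (comp (coeq α β) r).apex) : γ :=
  quotLift (P := fun w => (coeq α β).t w = r.s z.1.2) (fun y h => f y z.1.2 h)
    (by rintro _ _ ⟨y, rfl, rfl⟩ h h'; exact hf _ _ _ _) z.1.1 z.2

end SplitMultFun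

/-! ## The double category of monads and bimodules in `SMult` -/

namespace ModSMult

open SplitMultFun

variable {M N K L : LooseMonad SMult.{u}}

/-- The composite of bimodules: the coequaliser of the two actions of `N`. -/
abbrev compLoose (P : Bimodule M N) (Q : Bimodule N K) : SplitMultFun M.obj K.obj :=
  coeq (SMult.hcomp P.ract (SMult.cellId Q.loose))
    (SMult.globComp (SMult.assoc P.loose N.loose Q.loose)
      (SMult.hcomp (SMult.cellId P.loose) Q.lact))

section elements

variable (P : Bimodule M N) (Q : Bimodule N K)

lemma t_lact {m : M.loose.apex} {x : P.loose.apex} (h : M.loose.t m = P.loose.s x) :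
    P.loose.t (P.lact.map ⟨(m, x), h⟩) = P.loose.t x := P.lact.t_map _

lemma s_lact {m : M.loose.apex} {x : P.loose.apex} (h : M.loose.t m = P.loose.s x) :
    P.loose.s (P.lact.map ⟨(m, x), h⟩) = M.loose.s m := P.lact.s_map _

lemma t_ract {x : P.loose.apex} {n : N.loose.apex} (h : P.loose.t x = N.loose.s n) :
    P.loose.t (P.ract.map ⟨(x, n), h⟩) = N.loose.t n := P.ract.t_map _

lemma s_ract {x : P.loose.apex} {n : N.loose.apex} (h : P.loose.t x = N.loose.s n) :
    P.loose.s (P.ract.map ⟨(x, n), h⟩) = P.loose.s x := P.ract.s_map _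

lemma t_mul {m m' : M.loose.apex} (h : M.loose.t m = M.loose.s m') :
    M.loose.t (M.mul.map ⟨(m, m'), h⟩) = M.loose.t m' := M.mul.t_map _

lemma s_mul {m m' : M.loose.apex} (h : M.loose.t m = M.loose.s m') :
    M.loose.s (M.mul.map ⟨(m, m'), h⟩) = M.loose.s m := M.mul.s_map _

lemma t_one (a) : M.loose.t (M.one.map a) = a := M.one.t_map a
lemma s_one (a) : M.loose.s (M.one.map a) = a := M.one.s_map a
lemma one_eq (a) : M.one.map a = M.loose.σ a := M.one.map_σ a

lemma mul_lact (m m' : M.loose.apex) (x : P.loose.apex) (h : M.loose.t m = M.loose.s m')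
    (h' : M.loose.t m' = P.loose.s x) :
    P.lact.map ⟨(M.mul.map ⟨(m, m'), h⟩, x), (t_mul _).trans h'⟩ =
      P.lact.map ⟨(m, P.lact.map ⟨(m', x), h'⟩), h.trans (s_lact P _).symm⟩ :=
  congrFun (congrArg Cell.map P.mul_lact) ⟨(⟨(m, m'), h⟩, x), h'⟩

lemma ract_mul (x : P.loose.apex) (n n' : N.loose.apex) (h : P.loose.t x = N.loose.s n)
    (h' : N.loose.t n = N.loose.s n') :
    P.ract.map ⟨(P.ract.map ⟨(x, n), h⟩, n'), (t_ract P _).trans h'⟩ =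
      P.ract.map ⟨(x, N.mul.map ⟨(n, n'), h'⟩), h.trans (s_mul _).symm⟩ :=
  congrFun (congrArg Cell.map P.ract_mul) ⟨(⟨(x, n), h⟩, n'), h'⟩

lemma lact_ract (m : M.loose.apex) (x : P.loose.apex) (n : N.loose.apex)
    (h : M.loose.t m = P.loose.s x) (h' : P.loose.t x = N.loose.s n) :
    P.ract.map ⟨(P.lact.map ⟨(m, x), h⟩, n), (t_lact P _).trans h'⟩ =
      P.lact.map ⟨(m, P.ract.map ⟨(x, n), h'⟩), h.trans (s_ract P _).symm⟩ :=
  congrFun (congrArg Cell.map P.lact_ract) ⟨(⟨(m, x), h⟩, n), h'⟩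

lemma one_lact_of_eq {x : P.loose.apex} {a : M.obj} (h : a = P.loose.s x) :
    P.lact.map ⟨(M.one.map a, x), (M.one.t_map a).trans h⟩ = x :=
  congrFun (congrArg Cell.map P.one_lact) ⟨(a, x), h⟩

lemma ract_one_of_eq {x : P.loose.apex} {a : N.obj} (h : P.loose.t x = a) :
    P.ract.map ⟨(x, N.one.map a), h.trans (N.one.s_map a).symm⟩ = x :=
  congrFun (congrArg Cell.map P.ract_one) ⟨(x, a), h⟩

lemma t_σ (M : LooseMonad SMult.{u}) (a : M.obj) : M.loose.t (M.loose.σ a) = a := by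
  have h₁ : M.loose.t (M.one.map a) = a := M.one.t_map a
  have h₂ : M.one.map a = M.loose.σ a := M.one.map_σ a
  rwa [h₂] at h₁

/-- The class of a composable pair in the composite bimodule. -/
abbrev mk (x : P.loose.apex) (y : Q.loose.apex) (h : P.loose.t x = Q.loose.s y) :
    (compLoose P Q).apex :=
  Quot.mk _ ⟨(x, y), h⟩

lemma mk_congr {x x' : P.loose.apex} {y y' : Q.loose.apex} (hx : x = x') (hy : y = y')
    (h : P.loose.t x = Q.loose.s y) (h' : P.loose.t x' = Q.loose.s y') :
    mk P Q x y h = mk P Q x' y' h' := by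
  subst hx hy; rfl

lemma mk_eq (x : P.loose.apex) (n : N.loose.apex) (y : Q.loose.apex)
    (h : P.loose.t x = N.loose.s n) (h' : N.loose.t n = Q.loose.s y) :
    mk P Q (P.ract.map ⟨(x, n), h⟩) y ((t_ract P _).trans h') =
      mk P Q x (Q.lact.map ⟨(n, y), h'⟩) (h.trans (s_lact Q _).symm) :=
  Quot.sound ⟨⟨(⟨(x, n), h⟩, y), h'⟩, rfl, rfl⟩

end elements

/-- The left action on the composite bimodule, `m · [x, y] = [m · x, y]`. -/
abbrev compLact (P : Bimodule M N) (Q : Bimodule N K) :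
    SMult.Glob (SMult.comp M.loose (compLoose P Q)) (compLoose P Q) where
  map := liftRight
    (fun m z h => mk P Q (P.lact.map ⟨(m, z.1.1), h⟩) z.1.2 ((t_lact P _).trans z.2))
    (by
      rintro m ⟨⟨⟨⟨x, n⟩, h₁⟩, y⟩, h₂⟩ h h'
      exact (mk_congr P Q (lact_ract P m x n h' h₁).symm rfl _ _).trans (mk_eq P Q (P.lact.map ⟨(m, x), h'⟩) n y
          ((t_lact P h').trans h₁) h₂))
  s_map := by
    rintro ⟨⟨m, ⟨z⟩⟩, h⟩
    exact P.lact.s_map _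
  t_map := by
    rintro ⟨⟨m, ⟨z⟩⟩, h⟩
    rfl
  map_σ a := by
    exact mk_congr P Q (P.lact.map_σ a)
      (congrArg (fun b => Q.loose.σ (P.loose.t (P.loose.σ b))) (t_σ M a)) _ _

/-- The right action on the composite bimodule, `[x, y] · k = [x, y · k]`. -/
abbrev compRact (P : Bimodule M N) (Q : Bimodule N K) :
    SMult.Glob (SMult.comp (compLoose P Q) K.loose) (compLoose P Q) where
  map := liftLeft
    (fun z k h => mk P Q z.1.1 (Q.ract.map ⟨(z.1.2, k), h⟩) (z.2.trans (s_ract Q _).symm))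
    (by
      rintro ⟨⟨⟨⟨x, n⟩, h₁⟩, y⟩, h₂⟩ k h h'
      exact (mk_eq P Q x n (Q.ract.map ⟨(y, k), h⟩) h₁ (h₂.trans (s_ract Q h).symm)).trans
        (mk_congr P Q rfl (lact_ract Q n y k h₂ h).symm _
          (h₁.trans ((s_lact Q h₂).symm.trans (s_ract Q h').symm))))
  s_map := by
    rintro ⟨⟨⟨z⟩, k⟩, h⟩
    rfl
  t_map := by
    rintro ⟨⟨⟨z⟩, k⟩, h⟩
    exact Q.ract.t_map _
  map_σ a := by
    exact mk_congr P Q rfl (Q.ract.map_σ _) _ _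

/-- The composite bimodule. -/
abbrev comp (P : Bimodule M N) (Q : Bimodule N K) : Bimodule M K where
  loose := compLoose P Q
  lact := compLact P Q
  ract := compRact P Q
  mul_lact := by
    refine Cell.ext (funext ?_)
    rintro ⟨⟨⟨⟨m, m'⟩, h⟩, ⟨⟨⟨x, y⟩, e⟩⟩⟩, h'⟩
    exact mk_congr P Q (mul_lact P m m' x h h') rfl _ _
  one_lact := by
    refine Cell.ext (funext ?_)
    rintro ⟨⟨a, ⟨⟨⟨x, y⟩, e⟩⟩⟩, h⟩
    exact mk_congr P Q (one_lact_of_eq P h) rfl _ _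
  ract_mul := by
    refine Cell.ext (funext ?_)
    rintro ⟨⟨⟨⟨⟨⟨⟨x, y⟩, e⟩⟩, k⟩, h⟩, k'⟩, h'⟩
    exact mk_congr P Q rfl (ract_mul Q y k k' h h') _ _
  ract_one := by
    refine Cell.ext (funext ?_)
    rintro ⟨⟨⟨⟨⟨x, y⟩, e⟩⟩, a⟩, h⟩
    exact mk_congr P Q rfl (ract_one_of_eq Q h) _ _
  lact_ract := by
    refine Cell.ext (funext ?_)
    rintro ⟨⟨⟨⟨m, ⟨⟨⟨x, y⟩, e⟩⟩⟩, h⟩, k⟩, h'⟩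
    rfl

section cells

variable {M' N' K' : LooseMonad SMult.{u}} {P : Bimodule M N} {P' : Bimodule M' N'}
  {f : M ⟶ M'} {g : N ⟶ N'}

lemma map_lact (α : Bimodule.Cell f g P P') (m : M.loose.apex) (x : P.loose.apex)
    (h : M.loose.t m = P.loose.s x) (h' : M'.loose.t (f.cell.map m) = P'.loose.s (α.cell.map x)) :
    α.cell.map (P.lact.map ⟨(m, x), h⟩) = P'.lact.map ⟨(f.cell.map m, α.cell.map x), h'⟩ :=
  congrFun (congrArg Cell.map α.map_lact) ⟨(m, x), h⟩

lemma map_ract (α : Bimodule.Cell f g P P') (x : P.loose.apex) (n : N.loose.apex)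
    (h : P.loose.t x = N.loose.s n) (h' : P'.loose.t (α.cell.map x) = N'.loose.s (g.cell.map n)) :
    α.cell.map (P.ract.map ⟨(x, n), h⟩) = P'.ract.map ⟨(α.cell.map x, g.cell.map n), h'⟩ :=
  congrFun (congrArg Cell.map α.map_ract) ⟨(x, n), h⟩

end cells

/-- Loose composition of cells between bimodules, `[x, y] ↦ [α x, β y]`. -/
abbrev hcomp {M' N' K' : LooseMonad SMult.{u}} {f : M ⟶ M'} {g : N ⟶ N'} {h : K ⟶ K'}
    {P : Bimodule M N} {Q : Bimodule N K} {P' : Bimodule M' N'} {Q' : Bimodule N' K'}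
    (α : Bimodule.Cell f g P P') (β : Bimodule.Cell g h Q Q') :
    Bimodule.Cell f h (comp P Q) (comp P' Q') where
  cell :=
    { map := Quot.lift (fun z => Quot.mk _ ((SMult.hcomp α.cell β.cell).map z)) (by
        rintro _ _ ⟨⟨⟨⟨⟨x, n⟩, h₁⟩, y⟩, h₂⟩, rfl, rfl⟩
        have e₁ : P'.loose.t (α.cell.map x) = N'.loose.s (g.cell.map n) :=
          (α.cell.t_map x).trans ((congrArg g.tight h₁).trans (g.cell.s_map n).symm)
        have e₂ : N'.loose.t (g.cell.map n) = Q'.loose.s (β.cell.map y) :=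
          (g.cell.t_map n).trans ((congrArg g.tight h₂).trans (β.cell.s_map y).symm)
        exact (mk_congr P' Q' (map_ract α x n h₁ e₁) rfl _ _).trans
          ((mk_eq P' Q' _ _ _ e₁ e₂).trans
            (mk_congr P' Q' rfl (map_lact β n y h₂ e₂).symm _ _)))
      s_map := by
        rintro ⟨z⟩
        exact α.cell.s_map _
      t_map := by
        rintro ⟨z⟩
        exact β.cell.t_map _
      map_σ := fun a => congrArg (Quot.mk _) ((SMult.hcomp α.cell β.cell).map_σ a) }
  map_lact := by
    refine Cell.ext (funext ?_)
    rintro ⟨⟨m, ⟨⟨⟨x, y⟩, e⟩⟩⟩, e'⟩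
    exact mk_congr P' Q' (map_lact α m x e' _) rfl _ _
  map_ract := by
    refine Cell.ext (funext ?_)
    rintro ⟨⟨⟨⟨⟨x, y⟩, e⟩⟩, k⟩, e'⟩
    exact mk_congr P' Q' rfl (map_ract β y k e' _) _ _

/-- The associator, `[[x, y], z] ↦ [x, [y, z]]`. -/
abbrev assoc (P : Bimodule M N) (Q : Bimodule N K) (R : Bimodule K L) :
    Bimodule.Cell (𝟙 M) (𝟙 L) (comp (comp P Q) R) (comp P (comp Q R)) where
  cell :=
    { map := Quot.lift (liftLeft
        (fun w z h => mk P (comp Q R) w.1.1 (mk Q R w.1.2 z h) w.2)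
        (by
          rintro ⟨⟨⟨⟨x, n⟩, h₁⟩, y⟩, h₂⟩ z h h'
          exact mk_eq P (comp Q R) x n (mk Q R y z h) h₁ h₂)) (by
        rintro _ _ ⟨⟨⟨⟨⟨⟨⟨⟨x, y⟩, e⟩⟩, k⟩, h₁⟩, z⟩, h₂⟩, rfl, rfl⟩
        exact mk_congr P (comp Q R) rfl (mk_eq Q R y k z h₁ h₂) _ _)
      s_map := by
        rintro ⟨⟨⟨⟨⟨⟨x, y⟩, e⟩⟩, z⟩, h⟩⟩
        rfl
      t_map := by
        rintro ⟨⟨⟨⟨⟨⟨x, y⟩, e⟩⟩, z⟩, h⟩⟩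
        rfl
      map_σ := fun _ => rfl }
  map_lact := by
    refine Cell.ext (funext ?_)
    rintro ⟨⟨m, ⟨⟨⟨⟨⟨⟨x, y⟩, e⟩⟩, z⟩, h⟩⟩⟩, h'⟩
    rfl
  map_ract := by
    refine Cell.ext (funext ?_)
    rintro ⟨⟨⟨⟨⟨⟨⟨⟨x, y⟩, e⟩⟩, z⟩, h⟩⟩, l⟩, h'⟩
    rfl

/-- The inverse of the associator. -/
abbrev assocInv (P : Bimodule M N) (Q : Bimodule N K) (R : Bimodule K L) :
    Bimodule.Cell (𝟙 M) (𝟙 L) (comp P (comp Q R)) (comp (comp P Q) R) where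
  cell :=
    { map := Quot.lift (liftRight
        (fun x w h => mk (comp P Q) R (mk P Q x w.1.1 h) w.1.2 w.2)
        (by
          rintro x ⟨⟨⟨⟨y, k⟩, h₁⟩, z⟩, h₂⟩ h h'
          exact mk_eq (comp P Q) R (mk P Q x y h') k z h₁ h₂)) (by
        rintro _ _ ⟨⟨⟨⟨⟨x, n⟩, h₁⟩, ⟨⟨⟨y, z⟩, e⟩⟩⟩, h₂⟩, rfl, rfl⟩
        exact mk_congr (comp P Q) R (mk_eq P Q x n y h₁ h₂) rfl _ _)
      s_map := by
        rintro ⟨⟨⟨x, ⟨⟨⟨y, z⟩, e⟩⟩⟩, h⟩⟩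
        rfl
      t_map := by
        rintro ⟨⟨⟨x, ⟨⟨⟨y, z⟩, e⟩⟩⟩, h⟩⟩
        rfl
      map_σ := fun _ => rfl }
  map_lact := by
    refine Cell.ext (funext ?_)
    rintro ⟨⟨m, ⟨⟨⟨x, ⟨⟨⟨y, z⟩, e⟩⟩⟩, h⟩⟩⟩, h'⟩
    rfl
  map_ract := by
    refine Cell.ext (funext ?_)
    rintro ⟨⟨⟨⟨⟨x, ⟨⟨⟨y, z⟩, e⟩⟩⟩, h⟩⟩, l⟩, h'⟩
    rfl

/-- The left unitor, `[m, x] ↦ m · x`. -/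
abbrev leftUnitor (P : Bimodule M N) :
    Bimodule.Cell (𝟙 M) (𝟙 N) (comp (Bimodule.unit M) P) P where
  cell :=
    { map := Quot.lift P.lact.map (by
        rintro _ _ ⟨⟨⟨⟨⟨m, m'⟩, h₁⟩, x⟩, h₂⟩, rfl, rfl⟩
        exact mul_lact P m m' x h₁ h₂)
      s_map := by
        rintro ⟨z⟩
        exact P.lact.s_map z
      t_map := by
        rintro ⟨z⟩
        exact P.lact.t_map z
      map_σ := P.lact.map_σ }
  map_lact := by
    refine Cell.ext (funext ?_)
    rintro ⟨⟨m, ⟨⟨⟨m', x⟩, e⟩⟩⟩, h⟩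
    exact mul_lact P m m' x h e
  map_ract := by
    refine Cell.ext (funext ?_)
    rintro ⟨⟨⟨⟨⟨m, x⟩, e⟩⟩, n⟩, h⟩
    exact (lact_ract P m x n e h).symm

/-- The inverse of the left unitor, `x ↦ [1, x]`. -/
abbrev leftUnitorInv (P : Bimodule M N) :
    Bimodule.Cell (𝟙 M) (𝟙 N) P (comp (Bimodule.unit M) P) where
  cell :=
    { map := fun x => mk (Bimodule.unit M) P (M.one.map (P.loose.s x)) x (M.one.t_map _)
      s_map := fun x => M.one.s_map _
      t_map := fun _ => rfl
      map_σ := fun a => mk_congr (Bimodule.unit M) P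
        ((congrArg M.one.map (P.loose.s_σ a)).trans (M.one.map_σ a))
        (congrArg P.loose.σ (t_σ M a).symm) _ _ }
  map_lact := by
    refine Cell.ext (funext ?_)
    rintro ⟨⟨m, x⟩, h⟩
    refine (mk_congr (Bimodule.unit M) P (congrArg M.one.map (s_lact P h)) rfl _
      ((M.one.t_map _).trans (s_lact P h).symm)).trans ?_
    refine (mk_eq (Bimodule.unit M) P (M.one.map (M.loose.s m)) m x (M.one.t_map _) h).symm.trans ?_
    exact mk_congr (Bimodule.unit M) P ((one_lact_of_eq (Bimodule.unit M) (x := m) rfl).trans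
      (ract_one_of_eq (Bimodule.unit M) (x := m) h).symm) rfl _ _
  map_ract := by
    refine Cell.ext (funext ?_)
    rintro ⟨⟨x, n⟩, h⟩
    exact mk_congr (Bimodule.unit M) P (congrArg M.one.map (s_ract P h)) rfl _ _

/-- The right unitor, `[x, n] ↦ x · n`. -/
abbrev rightUnitor (P : Bimodule M N) :
    Bimodule.Cell (𝟙 M) (𝟙 N) (comp P (Bimodule.unit N)) P where
  cell :=
    { map := Quot.lift P.ract.map (by
        rintro _ _ ⟨⟨⟨⟨⟨x, n⟩, h₁⟩, n'⟩, h₂⟩, rfl, rfl⟩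
        exact ract_mul P x n n' h₁ h₂)
      s_map := by
        rintro ⟨z⟩
        exact P.ract.s_map z
      t_map := by
        rintro ⟨z⟩
        exact P.ract.t_map z
      map_σ := P.ract.map_σ }
  map_lact := by
    refine Cell.ext (funext ?_)
    rintro ⟨⟨m, ⟨⟨⟨x, n⟩, e⟩⟩⟩, h⟩
    exact lact_ract P m x n h e
  map_ract := by
    refine Cell.ext (funext ?_)
    rintro ⟨⟨⟨⟨⟨x, n⟩, e⟩⟩, n'⟩, h⟩
    exact (ract_mul P x n n' e h).symm

/-- The inverse of the right unitor, `x ↦ [x, 1]`. -/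
abbrev rightUnitorInv (P : Bimodule M N) :
    Bimodule.Cell (𝟙 M) (𝟙 N) P (comp P (Bimodule.unit N)) where
  cell :=
    { map := fun x => mk P (Bimodule.unit N) x (N.one.map (P.loose.t x)) (N.one.s_map _).symm
      s_map := fun _ => rfl
      t_map := fun x => N.one.t_map _
      map_σ := fun a => mk_congr P (Bimodule.unit N) rfl (N.one.map_σ _) _ _ }
  map_lact := by
    refine Cell.ext (funext ?_)
    rintro ⟨⟨m, x⟩, h⟩
    exact mk_congr P (Bimodule.unit N) rfl (congrArg N.one.map (t_lact P h)) _ _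
  map_ract := by
    refine Cell.ext (funext ?_)
    rintro ⟨⟨x, n⟩, h⟩
    refine (mk_congr P (Bimodule.unit N) rfl (congrArg N.one.map (t_ract P h)) _
      ((t_ract P h).trans (N.one.s_map _).symm)).trans ?_
    refine (mk_eq P (Bimodule.unit N) x n (N.one.map (N.loose.t n)) h
      (N.one.s_map _).symm).trans ?_
    exact mk_congr P (Bimodule.unit N) rfl ((ract_one_of_eq (Bimodule.unit N) (x := n) rfl).trans
      (one_lact_of_eq (Bimodule.unit N) (x := n) h).symm) _ _

end ModSMult

open ModSMult in
/-- The double category of loose monads and bimodules in `SMult`. -/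
abbrev ModSMult : DoubleCategory.{u + 1, u, u + 1, u} where
  Obj := LooseMonad SMult.{u}
  Loose := Bimodule
  Cell := Bimodule.Cell
  cellId := Bimodule.Cell.id
  cellComp := Bimodule.Cell.comp
  cell_id_comp _ := rfl
  cell_comp_id _ := rfl
  cell_assoc _ _ _ _ _ _ _ _ _ _ _ := rfl
  unit := Bimodule.unit
  unitCell := Bimodule.unitCell
  unitCell_id _ := rfl
  unitCell_comp _ _ := rfl
  comp := ModSMult.comp
  hcomp := ModSMult.hcomp
  hcomp_id _ _ := Bimodule.Cell.ext (SplitMultFun.Cell.ext (by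
    refine funext ?_
    rintro ⟨z⟩
    rfl))
  hcomp_comp _ _ _ _ _ _ _ := Bimodule.Cell.ext (SplitMultFun.Cell.ext (by
    refine funext ?_
    rintro ⟨z⟩
    rfl))
  assoc := ModSMult.assoc
  assocInv := ModSMult.assocInv
  assoc_inv _ _ _ := Bimodule.Cell.ext (SplitMultFun.Cell.ext (by
    refine funext ?_
    rintro ⟨⟨⟨⟨⟨⟨x, y⟩, e⟩⟩, z⟩, h⟩⟩
    rfl))
  inv_assoc _ _ _ := Bimodule.Cell.ext (SplitMultFun.Cell.ext (by
    refine funext ?_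
    rintro ⟨⟨⟨x, ⟨⟨⟨y, z⟩, e⟩⟩⟩, h⟩⟩
    rfl))
  assoc_naturality _ _ _ := Bimodule.Cell.ext (SplitMultFun.Cell.ext (by
    refine funext ?_
    rintro ⟨⟨⟨⟨⟨⟨x, y⟩, e⟩⟩, z⟩, h⟩⟩
    rfl))
  leftUnitor := ModSMult.leftUnitor
  leftUnitorInv := ModSMult.leftUnitorInv
  leftUnitor_inv {M N} P := Bimodule.Cell.ext (SplitMultFun.Cell.ext (by
    refine funext ?_
    rintro ⟨⟨⟨m, x⟩, h⟩⟩
    refine (mk_congr (Bimodule.unit _) P (congrArg M.one.map (s_lact P h)) rfl _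
      ((M.one.t_map _).trans (s_lact P h).symm)).trans ?_
    refine (mk_eq (Bimodule.unit _) P _ m x (M.one.t_map _) h).symm.trans ?_
    exact mk_congr (Bimodule.unit _) P (one_lact_of_eq (Bimodule.unit _) rfl) rfl _ _))
  inv_leftUnitor P := Bimodule.Cell.ext (SplitMultFun.Cell.ext (by
    funext x
    exact one_lact_of_eq P rfl))
  leftUnitor_naturality α := Bimodule.Cell.ext (SplitMultFun.Cell.ext (by
    refine funext ?_
    rintro ⟨⟨⟨m, x⟩, h⟩⟩
    exact (map_lact α m x h _).symm))
  rightUnitor := ModSMult.rightUnitor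
  rightUnitorInv := ModSMult.rightUnitorInv
  rightUnitor_inv {M N} P := Bimodule.Cell.ext (SplitMultFun.Cell.ext (by
    refine funext ?_
    rintro ⟨⟨⟨x, n⟩, h⟩⟩
    refine (mk_congr P (Bimodule.unit _) rfl (congrArg N.one.map (t_ract P h)) _
      ((t_ract P h).trans (N.one.s_map _).symm)).trans ?_
    refine (mk_eq P (Bimodule.unit _) x n _ h (N.one.s_map _).symm).trans ?_
    exact mk_congr P (Bimodule.unit _) rfl (ract_one_of_eq (Bimodule.unit _) rfl) _ _))
  inv_rightUnitor P := Bimodule.Cell.ext (SplitMultFun.Cell.ext (by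
    funext x
    exact ract_one_of_eq P rfl))
  rightUnitor_naturality α := Bimodule.Cell.ext (SplitMultFun.Cell.ext (by
    refine funext ?_
    rintro ⟨⟨⟨x, n⟩, h⟩⟩
    exact (map_ract α x n h _).symm))
  pentagon _ _ _ _ := Bimodule.Cell.ext (SplitMultFun.Cell.ext (by
    refine funext ?_
    rintro ⟨⟨⟨⟨⟨⟨⟨⟨⟨x, y⟩, e⟩⟩, z⟩, h⟩⟩, w⟩, h'⟩⟩
    rfl))
  triangle P Q := Bimodule.Cell.ext (SplitMultFun.Cell.ext (by
    refine funext ?_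
    rintro ⟨⟨⟨⟨⟨⟨x, n⟩, e⟩⟩, y⟩, h⟩⟩
    exact (mk_eq P Q x n y e h).symm))

/-! ## Delta lenses -/

/-- A delta lens: a functor with a choice, for each object `a` of the source and morphism
`u : f a ⟶ b`, of a lift `lift a u : a ⟶ liftObj a u` with `f (lift a u) = u`, such that the
chosen lifts preserve identities and composition. Equations between morphisms whose endpoints are
only propositionally equal are stated with `eqToHom`. -/
structure DeltaLens where
  source : Cat.{u, u}
  target : Cat.{u, u}
  functor : source ⥤ target
  liftObj : ∀ (a : source) {b : target}, (functor.obj a ⟶ b) → source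
  lift : ∀ (a : source) {b : target} (u : functor.obj a ⟶ b), a ⟶ liftObj a u
  obj_liftObj : ∀ (a : source) {b : target} (u : functor.obj a ⟶ b),
    functor.obj (liftObj a u) = b
  map_lift : ∀ (a : source) {b : target} (u : functor.obj a ⟶ b),
    functor.map (lift a u) ≫ eqToHom (obj_liftObj a u) = u
  liftObj_id : ∀ a : source, liftObj a (𝟙 (functor.obj a)) = a
  lift_id : ∀ a : source, lift a (𝟙 (functor.obj a)) ≫ eqToHom (liftObj_id a) = 𝟙 a
  liftObj_comp : ∀ (a : source) {b c : target} (u : functor.obj a ⟶ b) (v : b ⟶ c),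
    liftObj a (u ≫ v) = liftObj (liftObj a u) (eqToHom (obj_liftObj a u) ≫ v)
  lift_comp : ∀ (a : source) {b c : target} (u : functor.obj a ⟶ b) (v : b ⟶ c),
    lift a (u ≫ v) ≫ eqToHom (liftObj_comp a u v) =
      lift a u ≫ lift (liftObj a u) (eqToHom (obj_liftObj a u) ≫ v)

namespace DeltaLens

/-- A morphism of delta lenses: a commutative square of functors that preserves chosen lifts. -/
@[ext]
structure Hom (P Q : DeltaLens.{u}) where
  top : P.source ⥤ Q.source
  base : P.target ⥤ Q.target
  comm : P.functor ⋙ base = top ⋙ Q.functor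
  obj_liftObj : ∀ (a : P.source) {b : P.target} (u : P.functor.obj a ⟶ b),
    top.obj (P.liftObj a u) =
      Q.liftObj (top.obj a) (eqToHom (Functor.congr_obj comm a).symm ≫ base.map u)
  map_lift : ∀ (a : P.source) {b : P.target} (u : P.functor.obj a ⟶ b),
    top.map (P.lift a u) ≫ eqToHom (obj_liftObj a u) =
      Q.lift (top.obj a) (eqToHom (Functor.congr_obj comm a).symm ≫ base.map u)

lemma lift_congr (P : DeltaLens.{u}) (a : P.source) {b : P.target} {u v : P.functor.obj a ⟶ b}
    (h : u = v) (e : P.liftObj a u = P.liftObj a v) : P.lift a u ≫ eqToHom e = P.lift a v := by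
  subst h; simp

/-- The identity morphism of a delta lens. -/
abbrev Hom.id (P : DeltaLens.{u}) : Hom P P where
  top := 𝟭 _
  base := 𝟭 _
  comm := rfl
  obj_liftObj a b u := by simp
  map_lift a b u := P.lift_congr a (by simp) _

/-- Composition of morphisms of delta lenses. -/
abbrev Hom.comp {P Q R : DeltaLens.{u}} (α : Hom P Q) (β : Hom Q R) : Hom P R where
  top := α.top ⋙ β.top
  base := α.base ⋙ β.base
  comm := by
    rw [← Functor.assoc, α.comm, Functor.assoc, β.comm, Functor.assoc]
  obj_liftObj a b u := by
    simp [α.obj_liftObj, β.obj_liftObj, eqToHom_map]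
  map_lift a b u := by
    have h₁ := congrArg β.top.map (α.map_lift a u)
    have h₂ := β.map_lift (α.top.obj a)
      (eqToHom (Functor.congr_obj α.comm a).symm ≫ α.base.map u)
    rw [← h₁] at h₂
    simp only [Functor.map_comp, eqToHom_map, Category.assoc, eqToHom_trans] at h₂
    have e : ∀ w, eqToHom (Functor.congr_obj β.comm (α.top.obj a)).symm ≫ β.base.map
        (eqToHom (Functor.congr_obj α.comm a).symm ≫ α.base.map u) = w →
        ∀ e, β.top.map (α.top.map (P.lift a u)) ≫ eqToHom e = R.lift _ w := by
      rintro _ rfl e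
      simpa [eqToHom_map] using h₂
    exact e _ (by simp [eqToHom_map]) _

instance : Category DeltaLens.{u} where
  Hom := Hom
  id := Hom.id
  comp := Hom.comp
  id_comp _ := rfl
  comp_id _ := rfl
  assoc _ _ _ := rfl

end DeltaLens

/-! A loose monad in `SMult` is a small category: the apex is its set of morphisms, and the section
must be `a ↦ 1_a` because the unit of the monad is a cell. A bimodule is a profunctor with a chosen
element out of each object of its source. A lax double functor on `Lo B` therefore amounts to a
category over each object of `B`, a set of elements over each morphism, an associative composition
of elements over composable morphisms, and a chosen element out of each point along each morphism,
stable under composition. A delta lens is this data displayed as a functor to `B`; normality says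
that the elements over an identity are exactly the morphisms of the fibre.

From a lens, `fibreFunctor` takes the fibres and the morphisms lying over `w`, with the chosen lifts
as section. Its axioms are associativity in the source (`overComp_assoc`) and the lens laws
(`OverHom.lift_id`, `OverHom.lift_comp`). It is normal because over an identity the bimodule is the
fibre monad itself.

From a lax double functor, `totalLens` projects a Grothendieck-style total category, whose
identities and chosen lifts are sections. The category axioms are `sec_mul`, `mul_sec_id` and
`mul_assoc`; the composition law of the lens is `mul_sec`, which says that the comparison cell
preserves sections. None of this needs normality. The comparison `unitTrans` with the fibres of the
total lens also exists in general; it is bijective once the unit comparison is, and normality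
supplies that (`ofFibre_bijective`). On the other side, an object of the source of a lens determines
its base object and a morphism its base morphism, so `counitFunctor` is an isomorphism (`total_ext`,
`counitFunctor_map_injective`).

Elements over morphisms that are only propositionally equal are compared by `HEq`. Since cells of
`Lo B` are equalities, their images act as the identity up to `HEq` (`cell_heq`). -/

namespace DeltaLens

/-! ### Morphisms of the source of a lens lying over a given morphism. -/

/-- The objects of the source of a lens over a given object of the target. -/
abbrev Fibre (L : DeltaLens.{u}) (x : L.target) : Type u := {a : L.source // L.functor.obj a = x}

/-- The morphisms of the source of a lens over a given morphism of the target. -/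
structure OverHom (L : DeltaLens.{u}) {x y : L.target} (w : x ⟶ y) : Type u where
  src : L.Fibre x
  tgt : L.Fibre y
  hom : src.1 ⟶ tgt.1
  fac : L.functor.map hom = eqToHom src.2 ≫ w ≫ eqToHom tgt.2.symm

/-- Objects over `x` as objects over an equal object. -/
abbrev Fibre.cast {L : DeltaLens.{u}} {x x' : L.target} (h : x = x') (a : L.Fibre x) :
    L.Fibre x' :=
  ⟨a.1, a.2.trans h⟩

namespace OverHom

variable {L : DeltaLens.{u}} {x y z : L.target}

/-- The endpoints are fields rather than indices, so equality can be tested in the source of the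
lens, with `eqToHom` absorbing the change of endpoints; `fac` is a proposition and plays no part. -/
lemma ext' {w : x ⟶ y} {m n : L.OverHom w} (hs : m.src.1 = n.src.1) (ht : m.tgt.1 = n.tgt.1)
    (h : m.hom ≫ eqToHom ht = eqToHom hs ≫ n.hom) : m = n := by
  obtain ⟨⟨a, _⟩, ⟨b, _⟩, m, _⟩ := m
  obtain ⟨⟨a', _⟩, ⟨b', _⟩, n, _⟩ := n
  dsimp only at hs ht
  subst hs ht
  obtain rfl : m = n := by simpa using h
  rfl

/-- Composition of morphisms over composable morphisms. -/
abbrev comp {w : x ⟶ y} {v : y ⟶ z} {t : x ⟶ z} (m : L.OverHom w) (n : L.OverHom v)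
    (h : m.tgt = n.src) (e : w ≫ v = t) : L.OverHom t where
  src := m.src
  tgt := n.tgt
  hom := m.hom ≫ eqToHom (congrArg Subtype.val h) ≫ n.hom
  fac := by simp [eqToHom_map, m.fac, n.fac, ← e]

/-- A morphism over `w` as a morphism over `v`, when `w` and `v` agree up to equality of their
sources and targets. -/
abbrev cast {x' y' : L.target} {w : x ⟶ y} {v : x' ⟶ y'} (hx : x = x') (hy : y = y')
    (h : w ≫ eqToHom hy = eqToHom hx ≫ v) (m : L.OverHom w) : L.OverHom v where
  src := m.src.cast hx
  tgt := m.tgt.cast hy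
  hom := m.hom
  fac := by
    subst hx hy
    obtain rfl : w = v := by simpa using h
    exact m.fac

/-- The chosen lift. -/
abbrev lift (w : x ⟶ y) (a : L.Fibre x) : L.OverHom w where
  src := a
  tgt := ⟨L.liftObj a.1 (eqToHom a.2 ≫ w), L.obj_liftObj _ _⟩
  hom := L.lift a.1 (eqToHom a.2 ≫ w)
  fac := by
    rw [← Category.assoc, ← comp_eqToHom_iff (L.obj_liftObj _ _)]
    exact L.map_lift a.1 (eqToHom a.2 ≫ w)

/-- The identity morphism of an object, over the identity. -/
abbrev id (a : L.Fibre x) : L.OverHom (𝟙 x) := ⟨a, a, 𝟙 _, by simp⟩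

lemma lift_eq_of_eq (a : L.source) {w w' : L.functor.obj a ⟶ y} (h : w = w') :
    L.lift a w = L.lift a w' ≫ eqToHom (by rw [h]) := by
  subst h; simp

/-- The identity law of the lens, in the form that makes the chosen lifts of `𝟙 x` the unit of the
fibre monad. -/
lemma lift_id (a : L.Fibre x) : lift (𝟙 x) a = id a := by
  obtain ⟨a, rfl⟩ := a
  have e : eqToHom rfl ≫ 𝟙 (L.functor.obj a) = 𝟙 _ := by simp
  refine ext' rfl ((congrArg (L.liftObj a) e).trans (L.liftObj_id a)) ?_
  refine (congrArg (· ≫ eqToHom _) (lift_eq_of_eq a e)).trans ?_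
  rw [Category.assoc, eqToHom_trans]
  exact (L.lift_id a).trans (Category.id_comp _).symm

/-- The composition law of the lens. It says that composition respects the section of a composite
span, `a ↦ (σ a, σ (t (σ a)))`. -/
lemma lift_comp (w : x ⟶ y) (v : y ⟶ z) (a : L.Fibre x) :
    lift (w ≫ v) a = comp (lift w a) (lift v (lift w a).tgt) rfl rfl := by
  have e : eqToHom a.2 ≫ w ≫ v = (eqToHom a.2 ≫ w) ≫ v := by simp
  refine ext' rfl ((congrArg (L.liftObj a.1) e).trans (L.liftObj_comp a.1 (eqToHom a.2 ≫ w) v)) ?_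
  refine (congrArg (· ≫ eqToHom _) (lift_eq_of_eq a.1 e)).trans ?_
  simpa only [Category.assoc, eqToHom_trans, eqToHom_refl, Category.id_comp] using
    L.lift_comp a.1 (eqToHom a.2 ≫ w) v

lemma lift_comp' (w : x ⟶ y) (v : y ⟶ z) (t : x ⟶ z) (h : w ≫ v = t) (a : L.Fibre x) :
    comp (lift w a) (lift v (lift w a).tgt) rfl h = lift t a := by
  subst h; exact (lift_comp w v a).symm

lemma comp_assoc {t : L.target} {p : x ⟶ y} {q : y ⟶ z} {r : z ⟶ t} {pq : x ⟶ z} {qr : y ⟶ t}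
    {s : x ⟶ t} (m : L.OverHom p) (n : L.OverHom q) (k : L.OverHom r) (h : m.tgt = n.src)
    (h' : n.tgt = k.src) (e₁ : p ≫ q = pq) (e₂ : q ≫ r = qr) (e₃ : pq ≫ r = s) (e₄ : p ≫ qr = s) :
    comp (comp m n h e₁) k h' e₃ = comp m (comp n k h' e₂) h e₄ :=
  ext' rfl rfl (by simp)

/-- The cast is the image of the associator of `Lo`, which is an equality of morphisms; this is the
associativity axiom of the lax functor on representatives. -/
lemma cast_comp_assoc {t : L.target} {p : x ⟶ y} {q : y ⟶ z} {r : z ⟶ t} (m : L.OverHom p)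
    (n : L.OverHom q) (k : L.OverHom r) (h : m.tgt = n.src) (h' : n.tgt = k.src)
    (e : ((p ≫ q) ≫ r) ≫ eqToHom rfl = eqToHom rfl ≫ p ≫ q ≫ r) :
    cast rfl rfl e (comp (comp m n h rfl) k h' rfl) = comp m (comp n k h' rfl) h rfl :=
  ext' rfl rfl (by simp)

/-- The section condition for reindexing to be a cell of `SMult`. -/
lemma cast_lift {x' y' : L.target} {w : x ⟶ y} {v : x' ⟶ y'} (hx : x = x') (hy : y = y')
    (h : w ≫ eqToHom hy = eqToHom hx ≫ v) (a : L.Fibre x) :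
    cast hx hy h (lift w a) = lift v (a.cast hx) := by
  subst hx hy
  obtain rfl : w = v := by simpa using h
  rfl

lemma lift_id_comp {w : x ⟶ y} (a : L.Fibre x) (m : L.OverHom w)
    (h : (lift (𝟙 x) a).tgt = m.src) (e : 𝟙 x ≫ w = w) : comp (lift (𝟙 x) a) m h e = m := by
  -- The target of the lift is only propositionally `a`, so the lift is replaced by a variable
  -- before the identity law is substituted.
  have key : ∀ (l : L.OverHom (𝟙 x)) (_ : l = id a) (h : l.tgt = m.src), comp l m h e = m := by
    rintro _ rfl h
    exact ext' (congrArg Subtype.val h) rfl (by simp)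
  exact key _ (lift_id a) h

lemma comp_lift_id {w : x ⟶ y} (m : L.OverHom w) (a : L.Fibre y)
    (h : m.tgt = a) (e : w ≫ 𝟙 y = w) : comp m (lift (𝟙 y) a) h e = m := by
  subst h
  have key : ∀ (l : L.OverHom (𝟙 y)) (_ : l = id m.tgt) (h : m.tgt = l.src),
      comp m l h e = m := by
    rintro _ rfl h
    exact ext' rfl rfl (by simp)
  exact key _ (lift_id _) _

end OverHom

/-! ### The lax double functor of fibres of a lens. -/

section fibre

variable (L : DeltaLens.{u})

/-- The morphisms over `w`, with the chosen lifts, as a split multivalued function. -/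
abbrev overSpan {x y : L.target} (w : x ⟶ y) : SplitMultFun (L.Fibre x) (L.Fibre y) where
  apex := L.OverHom w
  s := OverHom.src
  t := OverHom.tgt
  σ := OverHom.lift w
  s_σ _ := rfl

/-- Composition of the morphisms over composable morphisms, as a cell. -/
abbrev overComp {x y z : L.target} (w : x ⟶ y) (v : y ⟶ z) (t : x ⟶ z) (e : w ≫ v = t) :
    SMult.Glob (SMult.comp (L.overSpan w) (L.overSpan v)) (L.overSpan t) where
  map m := OverHom.comp m.1.1 m.1.2 m.2 e
  s_map _ := rfl
  t_map _ := rfl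
  map_σ a := OverHom.lift_comp' w v t e a

/-- The composites are free variables with equations, so that some of them may be `w` in place of `𝟙
x ≫ w` or `w ≫ 𝟙 y`. Every associativity law of the fibre monads and of the bimodules is then an
instance. -/
lemma overComp_assoc {x y z t : L.target} (a : x ⟶ y) (b : y ⟶ z) (c : z ⟶ t) (ab : x ⟶ z)
    (bc : y ⟶ t) (abc : x ⟶ t) (h₁ : a ≫ b = ab) (h₂ : b ≫ c = bc) (h₃ : ab ≫ c = abc)
    (h₄ : a ≫ bc = abc) :
    SMult.globComp (SMult.hcomp (L.overComp a b ab h₁) (SMult.cellId (L.overSpan c)))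
        (L.overComp ab c abc h₃) =
      SMult.globComp (SMult.globComp (SMult.assoc _ _ _)
        (SMult.hcomp (SMult.cellId (L.overSpan a)) (L.overComp b c bc h₂)))
        (L.overComp a bc abc h₄) := by
  refine SplitMultFun.Cell.ext (funext ?_)
  rintro ⟨⟨⟨⟨m, n⟩, h⟩, k⟩, h'⟩
  exact OverHom.comp_assoc m n k h h' h₁ h₂ h₃ h₄

/-- The chosen lifts of the identity are the identities. -/
abbrev overOne (x : L.target) : SMult.Glob (SMult.unit (L.Fibre x)) (L.overSpan (𝟙 x)) where
  map := OverHom.lift (𝟙 x)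
  s_map _ := rfl
  t_map a := congrArg OverHom.tgt (OverHom.lift_id a)
  map_σ _ := rfl

lemma overOne_comp {x y : L.target} (w : x ⟶ y) :
    SMult.globComp (SMult.hcomp (L.overOne x) (SMult.cellId (L.overSpan w)))
      (L.overComp _ _ _ (Category.id_comp w)) = SMult.leftUnitor (L.overSpan w) := by
  refine SplitMultFun.Cell.ext (funext ?_)
  rintro ⟨⟨a, m⟩, h⟩
  exact OverHom.lift_id_comp a m ((congrArg OverHom.tgt (OverHom.lift_id a)).trans h)
    (Category.id_comp w)

lemma comp_overOne {x y : L.target} (w : x ⟶ y) :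
    SMult.globComp (SMult.hcomp (SMult.cellId (L.overSpan w)) (L.overOne y))
      (L.overComp _ _ _ (Category.comp_id w)) = SMult.rightUnitor (L.overSpan w) := by
  refine SplitMultFun.Cell.ext (funext ?_)
  rintro ⟨⟨m, a⟩, h⟩
  exact OverHom.comp_lift_id m a h (Category.comp_id w)

/-- The fibre category of a lens, as a loose monad. -/
abbrev fibreMonad (x : L.target) : LooseMonad SMult.{u} where
  obj := L.Fibre x
  loose := L.overSpan (𝟙 x)
  mul := L.overComp _ _ _ (Category.id_comp _)
  one := L.overOne x
  mul_assoc := L.overComp_assoc _ _ _ _ _ _ _ _ _ _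
  one_mul := L.overOne_comp _
  mul_one := L.comp_overOne _

/-- The morphisms over `w`, as a bimodule between the fibres. -/
abbrev overBimodule {x y : L.target} (w : x ⟶ y) :
    Bimodule (L.fibreMonad x) (L.fibreMonad y) where
  loose := L.overSpan w
  lact := L.overComp _ _ _ (Category.id_comp _)
  ract := L.overComp _ _ _ (Category.comp_id _)
  mul_lact := L.overComp_assoc _ _ _ _ _ _ _ _ _ _
  one_lact := L.overOne_comp _
  ract_mul := L.overComp_assoc _ _ _ _ _ _ _ _ _ _
  ract_one := L.comp_overOne _
  lact_ract := L.overComp_assoc _ _ _ _ _ _ _ _ _ _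

variable {L}

/-- Reindexing of morphisms along equalities of objects, as a cell. -/
abbrev overCast {x y x' y' : L.target} {w : x ⟶ y} {v : x' ⟶ y'} (hx : x = x') (hy : y = y')
    (h : w ≫ eqToHom hy = eqToHom hx ≫ v) :
    SMult.Cell (↾(Fibre.cast hx)) (↾(Fibre.cast hy)) (L.overSpan w) (L.overSpan v) where
  map := OverHom.cast hx hy h
  s_map _ := rfl
  t_map _ := rfl
  map_σ a := OverHom.cast_lift hx hy h a

/-- The isomorphism of fibres over equal objects. -/
abbrev fibreCast {x x' : L.target} (h : x = x') :
    LooseMonad.Hom (L.fibreMonad x) (L.fibreMonad x') where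
  tight := ↾(Fibre.cast h)
  cell := overCast h h (by simp)
  map_mul := rfl
  map_one := SplitMultFun.Cell.ext (funext fun a => OverHom.cast_lift h h (by simp) a)

/-- Reindexing of morphisms along equalities of objects, as a cell of bimodules. -/
abbrev overBimoduleCast {x y x' y' : L.target} {w : x ⟶ y} {v : x' ⟶ y'} (hx : x = x')
    (hy : y = y') (h : w ≫ eqToHom hy = eqToHom hx ≫ v) :
    Bimodule.Cell (M := L.fibreMonad x) (N := L.fibreMonad y) (M' := L.fibreMonad x')
      (N' := L.fibreMonad y') (fibreCast hx) (fibreCast hy) (L.overBimodule w)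
      (L.overBimodule v) where
  cell := overCast hx hy h
  map_lact := rfl
  map_ract := rfl

/-- Composition of morphisms over composable morphisms, as a cell of bimodules. -/
abbrev overBimoduleComp {x y z : L.target} (w : x ⟶ y) (v : y ⟶ z) :
    ModSMult.Glob (ModSMult.comp (L.overBimodule w) (L.overBimodule v))
      (L.overBimodule (w ≫ v)) where
  cell :=
    { map := Quot.lift (L.overComp w v (w ≫ v) rfl).map (by
        rintro _ _ ⟨⟨⟨⟨⟨m, k⟩, h⟩, n⟩, h'⟩, rfl, rfl⟩
        -- The coequaliser identifies `(m k, n)` with `(m, k n)`, and composition in the source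
        -- cannot tell them apart.
        exact OverHom.comp_assoc m k n h h' (by simp) (by simp) (by simp) (by simp))
      s_map := by
        rintro ⟨m⟩
        rfl
      t_map := by
        rintro ⟨m⟩
        rfl
      map_σ := (L.overComp w v (w ≫ v) rfl).map_σ }
  map_lact := by
    refine SplitMultFun.Cell.ext (funext ?_)
    rintro ⟨⟨k, ⟨⟨⟨m, n⟩, h⟩⟩⟩, h'⟩
    exact OverHom.comp_assoc k m n h' h (by simp) (by simp) (by simp) (by simp)
  map_ract := by
    refine SplitMultFun.Cell.ext (funext ?_)
    rintro ⟨⟨⟨⟨⟨m, n⟩, h⟩⟩, k⟩, h'⟩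
    exact (OverHom.comp_assoc m n k h h' (by simp) (by simp) (by simp) (by simp)).symm

variable (L)

/-- The lax double functor of fibres of a delta lens. -/
def fibreFunctor : LaxDoubleFunctor (Lo L.target) ModSMult.{u} where
  tight :=
    { obj := fun x => L.fibreMonad x.as
      map := fun f => fibreCast (Discrete.eq_of_hom f) }
  loose w := L.overBimodule w
  cell α := overBimoduleCast _ _ α.down
  cell_id _ := rfl
  cell_comp _ _ _ _ := rfl
  -- The bimodule of morphisms over `𝟙 x` is by definition the fibre monad acting on itself, so an
  -- identity cell has the required type.
  unit x := ModSMult.cellId (Bimodule.unit (L.fibreMonad x.as))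
  mult w v := overBimoduleComp w v
  unit_naturality _ := rfl
  mult_naturality _ _ := Bimodule.Cell.ext (SplitMultFun.Cell.ext (by
    refine funext ?_
    rintro ⟨⟨⟨m, n⟩, h⟩⟩
    rfl))
  mult_assoc _ _ _ := Bimodule.Cell.ext (SplitMultFun.Cell.ext (by
    refine funext ?_
    rintro ⟨⟨⟨⟨⟨⟨m, n⟩, h⟩⟩, k⟩, h'⟩⟩
    exact OverHom.cast_comp_assoc m n k h h' (by simp)))
  unit_mult _ := Bimodule.Cell.ext (SplitMultFun.Cell.ext (by
    refine funext ?_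
    rintro ⟨⟨⟨m, n⟩, h⟩⟩
    rfl))
  mult_unit _ := Bimodule.Cell.ext (SplitMultFun.Cell.ext (by
    refine funext ?_
    rintro ⟨⟨⟨m, n⟩, h⟩⟩
    rfl))

/-- The indexed category of fibres of a delta lens. -/
def fibres : Idx.{u + 1, u, u + 1, u, u} ModSMult.{u} := ⟨L.target, L.fibreFunctor⟩

lemma fibres_isNormal : L.fibres.fib.IsNormal := fun _ => ⟨rfl, HEq.rfl⟩

end fibre

/-! ### The action of lens morphisms on fibres. -/

section

variable {L L' : DeltaLens.{u}} (H : Hom L L') {x y z : L.target}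

/-- The action of a morphism of lenses on the objects over `x`. -/
abbrev Fibre.map (x : L.target) (a : L.Fibre x) : L'.Fibre (H.base.obj x) :=
  ⟨H.top.obj a.1, (Functor.congr_obj H.comm a.1).symm.trans (congrArg H.base.obj a.2)⟩

namespace OverHom

/-- The action of a morphism of lenses on the morphisms over `w`. -/
abbrev map {w : x ⟶ y} (m : L.OverHom w) : L'.OverHom (H.base.map w) where
  src := Fibre.map H x m.src
  tgt := Fibre.map H y m.tgt
  hom := H.top.map m.hom
  fac := by
    have h := Functor.congr_hom H.comm.symm m.hom
    dsimp only [Functor.comp_map, Functor.comp_obj] at h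
    rw [h, m.fac]
    simp [eqToHom_map]

/-- This is where preservation of chosen lifts enters: it is the section condition for `overMap` to
be a cell. -/
lemma map_lift (w : x ⟶ y) (a : L.Fibre x) :
    map H (lift w a) = lift (H.base.map w) (Fibre.map H x a) := by
  have e : eqToHom (Functor.congr_obj H.comm a.1).symm ≫ H.base.map (eqToHom a.2 ≫ w) =
      eqToHom (Fibre.map H x a).2 ≫ H.base.map w := by simp [eqToHom_map]
  refine ext' rfl ((H.obj_liftObj a.1 (eqToHom a.2 ≫ w)).trans
    (congrArg (L'.liftObj (H.top.obj a.1)) e)) ?_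
  have h := H.map_lift a.1 (eqToHom a.2 ≫ w)
  rw [lift_eq_of_eq _ e] at h
  refine Eq.trans ?_ (Category.id_comp _).symm
  simpa only [Category.assoc, eqToHom_trans, eqToHom_refl, Category.comp_id] using
    congrArg (· ≫ eqToHom (congrArg (L'.liftObj (H.top.obj a.1)) e)) h

/-- Functoriality of `H.top`. The cast is needed because `H` sends morphisms over `𝟙 y` to morphisms
over `H.base.map (𝟙 y)`, which is only propositionally an identity. -/
lemma map_comp_id {w : y ⟶ z} (k : L.OverHom (𝟙 y)) (m : L.OverHom w) (h : k.tgt = m.src)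
    (e : 𝟙 y ≫ w = w)
    (e' : 𝟙 (H.base.obj y) ≫ H.base.map w = H.base.map w)
    (e'' : H.base.map (𝟙 y) ≫ eqToHom rfl = eqToHom rfl ≫ 𝟙 (H.base.obj y)) :
    map H (comp k m h e) = comp (cast rfl rfl e'' (map H k)) (map H m)
      (congrArg (Fibre.map H y) h) e' :=
  ext' rfl rfl (by simp [eqToHom_map])

lemma map_id_comp {w : y ⟶ z} (m : L.OverHom w) (k : L.OverHom (𝟙 z)) (h : m.tgt = k.src)
    (e : w ≫ 𝟙 z = w)
    (e' : H.base.map w ≫ 𝟙 (H.base.obj z) = H.base.map w)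
    (e'' : H.base.map (𝟙 z) ≫ eqToHom rfl = eqToHom rfl ≫ 𝟙 (H.base.obj z)) :
    map H (comp m k h e) = comp (map H m) (cast rfl rfl e'' (map H k))
      (congrArg (Fibre.map H z) h) e' :=
  ext' rfl rfl (by simp [eqToHom_map])

lemma map_comp_comp {w : x ⟶ y} {v : y ⟶ z} (m : L.OverHom w) (n : L.OverHom v)
    (h : m.tgt = n.src)
    (e' : (H.base.map w ≫ H.base.map v) ≫ eqToHom rfl = eqToHom rfl ≫ H.base.map (w ≫ v)) :
    map H (comp m n h rfl) = cast rfl rfl e'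
      (comp (map H m) (map H n) (congrArg (Fibre.map H y) h) rfl) :=
  ext' rfl rfl (by simp [eqToHom_map])

end OverHom

/-- The action of a morphism of lenses on the morphisms over `w`, as a cell. -/
abbrev overMap (w : x ⟶ y) :
    SMult.Cell (↾(Fibre.map H x)) (↾(Fibre.map H y)) (L.overSpan w)
      (L'.overSpan (H.base.map w)) where
  map := OverHom.map H
  s_map _ := rfl
  t_map _ := rfl
  map_σ a := OverHom.map_lift H w a

/-- The action of a morphism of lenses on a fibre, as a morphism of monads. -/
abbrev fibreHom (x : L.target) :
    LooseMonad.Hom (L.fibreMonad x) (L'.fibreMonad (H.base.obj x)) where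
  tight := ↾(Fibre.map H x)
  -- The second factor reindexes from `H.base.map (𝟙 x)` to `𝟙 (H.base.obj x)`.
  cell := SMult.cellComp (overMap H (𝟙 x))
    (overCast rfl rfl (by simp) : SMult.Cell (𝟙 _) (𝟙 _) _ (L'.overSpan (𝟙 (H.base.obj x))))
    (Category.comp_id _) (Category.comp_id _)
  map_mul := SplitMultFun.Cell.ext (by
    refine funext ?_
    rintro ⟨⟨m, n⟩, h⟩
    exact OverHom.ext' rfl rfl (by simp [eqToHom_map]))
  map_one := SplitMultFun.Cell.ext (funext fun a =>
    (congrArg (OverHom.cast rfl rfl (by simp)) (OverHom.map_lift H (𝟙 x) a)).trans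
      (OverHom.cast_lift rfl rfl (by simp) _))

/-- The action of a morphism of lenses on the morphisms over `w`, as a cell of bimodules. -/
abbrev overBimoduleMap (w : x ⟶ y) :
    Bimodule.Cell (M := L.fibreMonad x) (N := L.fibreMonad y)
      (M' := L'.fibreMonad (H.base.obj x)) (N' := L'.fibreMonad (H.base.obj y))
      (fibreHom H x) (fibreHom H y) (L.overBimodule w) (L'.overBimodule (H.base.map w)) where
  cell := overMap H w
  map_lact := SplitMultFun.Cell.ext (by
    refine funext ?_
    rintro ⟨⟨m, n⟩, h⟩
    exact OverHom.map_comp_id H m n h (by simp) (by simp) (by simp))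
  map_ract := SplitMultFun.Cell.ext (by
    refine funext ?_
    rintro ⟨⟨m, n⟩, h⟩
    exact OverHom.map_id_comp H m n h (by simp) (by simp) (by simp))

/-- The morphism of indexed categories of fibres induced by a morphism of lenses. -/
def fibresMap : Idx.Hom L.fibres L'.fibres where
  base := H.base
  trans :=
    { app :=
        { app := fun x => fibreHom H x.as
          naturality := fun _ _ _ => rfl }
      cell := fun w => overBimoduleMap H w
      naturality := fun _ => rfl
      unit := fun _ => rfl
      mult := fun _ _ => Bimodule.Cell.ext (SplitMultFun.Cell.ext (by
        refine funext ?_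
        rintro ⟨⟨⟨m, n⟩, h⟩⟩
        exact OverHom.map_comp_comp H m n h ((Category.comp_id _).trans
          ((H.base.map_comp _ _).symm.trans (Category.id_comp _).symm)))) }

end

lemma fibresMap_comp {L L' L'' : DeltaLens.{u}} (H : Hom L L') (K : Hom L' L'') :
    fibresMap (H.comp K) = (fibresMap H).comp (fibresMap K) := by
  refine congrArg (Idx.Hom.mk (P := L.fibres) (Q := L''.fibres) (H.base ⋙ K.base))
    (TightTrans.ext_tot (fun _ => ?_) (fun _ => ?_))
  · rfl
  · rfl

end DeltaLens

/-! ### Calculus of elements in a lax double functor to `Mod(SMult)`. -/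

namespace Idx

section

variable (P : Idx.{u + 1, u, u + 1, u, u} ModSMult.{u})

/-- The fibre monad over an object. -/
abbrev fibre (x : P.base) : LooseMonad SMult.{u} := P.fib.tight.obj ⟨x⟩

/-- The bimodule over a morphism. -/
abbrev bimod {x y : P.base} (w : x ⟶ y) : Bimodule (P.fibre x) (P.fibre y) :=
  P.fib.loose (A := ⟨x⟩) (B := ⟨y⟩) w

/-- The elements of the bimodule over a morphism. -/
abbrev Elt {x y : P.base} (w : x ⟶ y) : Type u := (P.bimod w).loose.apex

variable {P} {x y z t : P.base}

/-- Composition of elements over composable morphisms. -/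
abbrev mul {w : x ⟶ y} {v : y ⟶ z} (e : P.Elt w) (e' : P.Elt v)
    (h : (P.bimod w).loose.t e = (P.bimod v).loose.s e') : P.Elt (w ≫ v) :=
  (P.fib.mult (A := ⟨x⟩) (B := ⟨y⟩) (C := ⟨z⟩) w v).cell.map (ModSMult.mk _ _ e e' h)

/-- An element of the fibre monad as an element over the identity. -/
abbrev ofFibre (m : (P.fibre x).loose.apex) : P.Elt (𝟙 x) := (P.fib.unit ⟨x⟩).cell.map m

/-- The chosen element over a morphism. -/
abbrev sec (w : x ⟶ y) (a : (P.fibre x).obj) : P.Elt w := (P.bimod w).loose.σ a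

/-- A cell of `Lo` is an equality, hence after substitution an identity cell, which `cell_id` sends
to the identity. This removes the structure cells of `Lo` from every coherence axiom below. -/
lemma cell_heq {w v : x ⟶ y} {f : (⟨x⟩ : Discrete P.base) ⟶ ⟨x⟩}
    {g : (⟨y⟩ : Discrete P.base) ⟶ ⟨y⟩}
    (α : (Lo P.base).Cell (A := ⟨x⟩) (B := ⟨y⟩) (C := ⟨x⟩) (D := ⟨y⟩) f g w v) (e : P.Elt w) :
    HEq ((P.fib.cell α).cell.map e) e := by
  obtain rfl : f = 𝟙 _ := Subsingleton.elim _ _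
  obtain rfl : g = 𝟙 _ := Subsingleton.elim _ _
  obtain rfl : w = v := by simpa using α.down
  obtain rfl : α = (Lo P.base).cellId (A := ⟨x⟩) (B := ⟨y⟩) w :=
    PLift.down_injective (Subsingleton.elim _ _)
  exact heq_of_eq (congrFun (congrArg (fun c => c.cell.map)
    (P.fib.cell_id (A := ⟨x⟩) (B := ⟨y⟩) w)) e)

lemma sec_congr {w v : x ⟶ y} (h : w = v) {a b : (P.fibre x).obj} (h' : a = b) :
    HEq (P.sec w a) (P.sec v b) := by
  subst h h'; rfl

lemma t_sec_congr {w v : x ⟶ y} (h : w = v) {a b : (P.fibre x).obj} (h' : a = b) :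
    (P.bimod w).loose.t (P.sec w a) = (P.bimod v).loose.t (P.sec v b) := by
  subst h h'; rfl

lemma mul_congr {w w' : x ⟶ y} {v v' : y ⟶ z} {e : P.Elt w} {e' : P.Elt v} {d : P.Elt w'}
    {d' : P.Elt v'} (hw : w = w') (hv : v = v') (he : HEq e d) (he' : HEq e' d')
    (h : (P.bimod w).loose.t e = (P.bimod v).loose.s e')
    (h' : (P.bimod w').loose.t d = (P.bimod v').loose.s d') :
    HEq (mul e e' h) (mul d d' h') := by
  subst hw hv he he'; rfl

lemma s_mul {w : x ⟶ y} {v : y ⟶ z} (e : P.Elt w) (e' : P.Elt v)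
    (h : (P.bimod w).loose.t e = (P.bimod v).loose.s e') :
    (P.bimod (w ≫ v)).loose.s (mul e e' h) = (P.bimod w).loose.s e :=
  (P.fib.mult (A := ⟨x⟩) (B := ⟨y⟩) (C := ⟨z⟩) w v).cell.s_map (ModSMult.mk _ _ e e' h)

lemma t_mul {w : x ⟶ y} {v : y ⟶ z} (e : P.Elt w) (e' : P.Elt v)
    (h : (P.bimod w).loose.t e = (P.bimod v).loose.s e') :
    (P.bimod (w ≫ v)).loose.t (mul e e' h) = (P.bimod v).loose.t e' :=
  (P.fib.mult (A := ⟨x⟩) (B := ⟨y⟩) (C := ⟨z⟩) w v).cell.t_map (ModSMult.mk _ _ e e' h)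

/-- The comparison for composites is a cell and so preserves sections. This becomes the composition
law of the total lens. -/
lemma mul_sec (w : x ⟶ y) (v : y ⟶ z) (a : (P.fibre x).obj) :
    mul (P.sec w a) (P.sec v ((P.bimod w).loose.t (P.sec w a)))
      ((P.bimod v).loose.s_σ _).symm = P.sec (w ≫ v) a :=
  (P.fib.mult (A := ⟨x⟩) (B := ⟨y⟩) (C := ⟨z⟩) w v).cell.map_σ a

lemma ofFibre_σ (a : (P.fibre x).obj) : ofFibre ((P.fibre x).loose.σ a) = P.sec (𝟙 x) a :=
  (P.fib.unit ⟨x⟩).cell.map_σ a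

lemma s_ofFibre (m : (P.fibre x).loose.apex) :
    (P.bimod (𝟙 x)).loose.s (ofFibre m) = (P.fibre x).loose.s m :=
  (P.fib.unit ⟨x⟩).cell.s_map m

lemma t_ofFibre (m : (P.fibre x).loose.apex) :
    (P.bimod (𝟙 x)).loose.t (ofFibre m) = (P.fibre x).loose.t m :=
  (P.fib.unit ⟨x⟩).cell.t_map m

/-- The unit comparison preserves sections and targets, and in a monad the section at `a` is the
unit at `a`, which ends at `a`. -/
lemma t_sec_id (a : (P.fibre x).obj) : (P.bimod (𝟙 x)).loose.t (P.sec (𝟙 x) a) = a := by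
  rw [← ofFibre_σ, t_ofFibre, ModSMult.t_σ]

/-- The axiom `mult_assoc` evaluated at the class `[[e, e'], e'']`; the image of the associator of
`Lo` is discarded by `cell_heq`. -/
lemma mul_assoc {w : x ⟶ y} {v : y ⟶ z} {r : z ⟶ t} (e : P.Elt w) (e' : P.Elt v) (e'' : P.Elt r)
    (h : (P.bimod w).loose.t e = (P.bimod v).loose.s e')
    (h' : (P.bimod v).loose.t e' = (P.bimod r).loose.s e'') :
    HEq (mul (mul e e' h) e'' ((t_mul e e' h).trans h'))
      (mul e (mul e' e'' h') (h.trans (s_mul e' e'' h').symm)) :=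
  (cell_heq _ _).symm.trans (heq_of_eq (congrFun (congrArg (fun c => c.cell.map)
    (P.fib.mult_assoc (A := ⟨x⟩) (B := ⟨y⟩) (C := ⟨z⟩) (D := ⟨t⟩) w v r))
      (ModSMult.mk _ _ (ModSMult.mk _ _ e e' h) e'' h')))

/-- The axiom `unit_mult` evaluated at `[m, e]`, since the left unitor of bimodules is the left
action. -/
lemma ofFibre_mul {w : x ⟶ y} (m : (P.fibre x).loose.apex) (e : P.Elt w)
    (h : (P.fibre x).loose.t m = (P.bimod w).loose.s e) :
    HEq (mul (ofFibre m) e ((t_ofFibre m).trans h)) ((P.bimod w).lact.map ⟨(m, e), h⟩) :=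
  (cell_heq _ _).symm.trans (heq_of_eq (congrFun (congrArg (fun c => c.cell.map)
    (P.fib.unit_mult (A := ⟨x⟩) (B := ⟨y⟩) w)) (ModSMult.mk (Bimodule.unit _) _ m e h)))

lemma mul_ofFibre {w : x ⟶ y} (e : P.Elt w) (m : (P.fibre y).loose.apex)
    (h : (P.bimod w).loose.t e = (P.fibre y).loose.s m) :
    HEq (mul e (ofFibre m) (h.trans (s_ofFibre m).symm)) ((P.bimod w).ract.map ⟨(e, m), h⟩) :=
  (cell_heq _ _).symm.trans (heq_of_eq (congrFun (congrArg (fun c => c.cell.map)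
    (P.fib.mult_unit (A := ⟨x⟩) (B := ⟨y⟩) w)) (ModSMult.mk _ (Bimodule.unit _) e m h)))

/-- The section over an identity comes from the section of the fibre monad, which is its unit, so
the claim reduces to the unit law of the left action. Normality plays no role. -/
lemma sec_mul {w : x ⟶ y} (e : P.Elt w) (a : (P.fibre x).obj)
    (h : (P.bimod (𝟙 x)).loose.t (P.sec (𝟙 x) a) = (P.bimod w).loose.s e) :
    HEq (mul (P.sec (𝟙 x) a) e h) e := by
  have h' := (t_sec_id a).symm.trans h
  have h'' : (P.fibre x).loose.t ((P.fibre x).loose.σ a) = (P.bimod w).loose.s e :=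
    (ModSMult.t_σ _ a).trans h'
  refine (mul_congr rfl rfl (heq_of_eq (ofFibre_σ a).symm) HEq.rfl h
    ((t_ofFibre _).trans h'')).trans ((ofFibre_mul _ e h'').trans (heq_of_eq ?_))
  refine Eq.trans ?_ (ModSMult.one_lact_of_eq (P.bimod w) h')
  -- The two sides act by `σ a` and by the unit at `a`, which agree because the unit of the monad is
  -- a cell.
  congr 4
  exact ((P.fibre x).one.map_σ a).symm

lemma mul_sec_id {w : x ⟶ y} (e : P.Elt w) (a : (P.fibre y).obj)
    (h : (P.bimod w).loose.t e = a) :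
    HEq (mul e (P.sec (𝟙 y) a) (h.trans ((P.bimod (𝟙 y)).loose.s_σ a).symm)) e := by
  have h'' : (P.bimod w).loose.t e = (P.fibre y).loose.s ((P.fibre y).loose.σ a) :=
    h.trans ((P.fibre y).loose.s_σ a).symm
  refine (mul_congr rfl rfl HEq.rfl (heq_of_eq (ofFibre_σ a).symm) _
    (h''.trans (s_ofFibre _).symm)).trans ((mul_ofFibre e _ h'').trans (heq_of_eq ?_))
  refine Eq.trans ?_ (ModSMult.ract_one_of_eq (P.bimod w) h)
  congr 4
  exact ((P.fibre y).one.map_σ a).symm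

end

/-! ### The total category and the total lens. -/

/-- The objects of the total category of a lax double functor `Lo B → Mod(SMult)`. -/
structure Total (P : Idx.{u + 1, u, u + 1, u, u} ModSMult.{u}) : Type u where
  base : P.base
  pt : (P.fibre base).obj

namespace Total

variable {P : Idx.{u + 1, u, u + 1, u, u} ModSMult.{u}}

/-- The morphisms of the total category. -/
structure Hom (p q : Total P) : Type u where
  base : p.base ⟶ q.base
  elt : P.Elt base
  s_elt : (P.bimod base).loose.s elt = p.pt
  t_elt : (P.bimod base).loose.t elt = q.pt

lemma Hom.ext' {p q : Total P} {m n : Hom p q} (h : m.base = n.base) (h' : HEq m.elt n.elt) :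
    m = n := by
  obtain ⟨_, _, _, _⟩ := m
  obtain ⟨_, _, _, _⟩ := n
  dsimp only at h
  subst h
  obtain rfl := eq_of_heq h'
  rfl

/-- Taking sections as identities makes the category available without normality, and makes the
identity law for lifts immediate. -/
instance : Category (Total P) where
  Hom := Hom
  id p := ⟨𝟙 _, P.sec _ p.pt, (P.bimod _).loose.s_σ _, t_sec_id _⟩
  comp m n := ⟨m.base ≫ n.base, mul m.elt n.elt (m.t_elt.trans n.s_elt.symm),
    (s_mul _ _ _).trans m.s_elt, (t_mul _ _ _).trans n.t_elt⟩
  id_comp _ := Hom.ext' (Category.id_comp _) (sec_mul _ _ _)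
  comp_id m := Hom.ext' (Category.comp_id _) (mul_sec_id _ _ m.t_elt)
  assoc m n k := Hom.ext' (Category.assoc _ _ _)
    (mul_assoc _ _ _ (m.t_elt.trans n.s_elt.symm) (n.t_elt.trans k.s_elt.symm))

/-- Both targets lie over the same `y`, so the transport only changes the point and leaves base and
element untouched. -/
lemma comp_eqToHom_eq {p : Total P} {y : P.base} {b b' : (P.fibre y).obj} (m : p ⟶ ⟨y, b⟩)
    (n : p ⟶ ⟨y, b'⟩) (h : (⟨y, b⟩ : Total P) = ⟨y, b'⟩) (h₁ : m.base = n.base)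
    (h₂ : HEq m.elt n.elt) : m ≫ eqToHom h = n := by
  obtain rfl : b = b' := by simpa using h
  rw [eqToHom_refl, Category.comp_id]
  exact Hom.ext' h₁ h₂

/-- The projection of the total category. -/
abbrev proj (P : Idx.{u + 1, u, u + 1, u, u} ModSMult.{u}) : Total P ⥤ P.base where
  obj p := p.base
  map m := m.base

end Total

/-- The total lens of a lax double functor `Lo B → Mod(SMult)`. -/
def totalLens (P : Idx.{u + 1, u, u + 1, u, u} ModSMult.{u}) : DeltaLens.{u} where
  source := Cat.of (Total P)
  target := P.base
  functor := Total.proj P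
  liftObj p y w := ⟨y, (P.bimod w).loose.t (P.sec w p.pt)⟩
  lift p y w := ⟨w, P.sec w p.pt, (P.bimod w).loose.s_σ _, rfl⟩
  obj_liftObj _ _ _ := rfl
  map_lift _ _ _ := Category.comp_id _
  liftObj_id p := congrArg (Total.mk p.base) (t_sec_id p.pt)
  -- The lift of an identity and the identity have literally the same element, the section; only the
  -- recorded target differs.
  lift_id p := Total.comp_eqToHom_eq _ _ _ rfl HEq.rfl
  liftObj_comp p y z w v := congrArg (Total.mk z) (by
    rw [← mul_sec, t_mul]
    exact t_sec_congr (Category.id_comp _).symm rfl)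
  lift_comp p y z w v := by
    -- Lifts lie over the prescribed object by `rfl`, so the transport in the composition law is `𝟙
    -- y`.
    have e : w ≫ v = w ≫ 𝟙 y ≫ v := by rw [Category.id_comp]
    refine Total.comp_eqToHom_eq _ _ _ e ?_
    exact (sec_congr e rfl).trans (heq_of_eq (mul_sec w (𝟙 y ≫ v) p.pt).symm)

/-! ### Functoriality of the total lens. -/

section

variable {P Q : Idx.{u + 1, u, u + 1, u, u} ModSMult.{u}}

namespace Hom

variable (α : Hom P Q)

/-- The action of a morphism on the elements over `w`. -/
abbrev onElt {x y : P.base} {w : x ⟶ y} (e : P.Elt w) : Q.Elt (α.base.map w) :=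
  (α.trans.cell (A := ⟨x⟩) (B := ⟨y⟩) w).cell.map e

/-- The action of a morphism on the elements of the fibre monads. -/
abbrev onObj {x : P.base} (a : (P.fibre x).obj) : (Q.fibre (α.base.obj x)).obj :=
  (α.trans.app.app ⟨x⟩).tight a

lemma s_onElt {x y : P.base} {w : x ⟶ y} (e : P.Elt w) :
    (Q.bimod (α.base.map w)).loose.s (α.onElt e) = α.onObj ((P.bimod w).loose.s e) :=
  (α.trans.cell (A := ⟨x⟩) (B := ⟨y⟩) w).cell.s_map e

lemma t_onElt {x y : P.base} {w : x ⟶ y} (e : P.Elt w) :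
    (Q.bimod (α.base.map w)).loose.t (α.onElt e) = α.onObj ((P.bimod w).loose.t e) :=
  (α.trans.cell (A := ⟨x⟩) (B := ⟨y⟩) w).cell.t_map e

lemma onElt_sec {x y : P.base} (w : x ⟶ y) (a : (P.fibre x).obj) :
    α.onElt (P.sec w a) = Q.sec (α.base.map w) (α.onObj a) :=
  (α.trans.cell (A := ⟨x⟩) (B := ⟨y⟩) w).cell.map_σ a

/-- Compatibility of the transformation with `mult`, evaluated at `[e, e']`. The target functor is
composed with `Lo.map α.base`, whose extra comparison cell is removed by `cell_heq`. -/
lemma onElt_mul {x y z : P.base} {w : x ⟶ y} {v : y ⟶ z} (e : P.Elt w) (e' : P.Elt v)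
    (h : (P.bimod w).loose.t e = (P.bimod v).loose.s e') :
    HEq (α.onElt (mul e e' h)) (mul (α.onElt e) (α.onElt e')
      ((α.t_onElt e).trans ((congrArg α.onObj h).trans (α.s_onElt e').symm))) :=
  (heq_of_eq (congrFun (congrArg (fun c => c.cell.map)
    (α.trans.mult (A := ⟨x⟩) (B := ⟨y⟩) (C := ⟨z⟩) w v))
      (ModSMult.mk _ _ e e' h))).trans (cell_heq _ _)

/-- The functor between total categories. -/
abbrev totalFunctor : Total P ⥤ Total Q where
  obj p := ⟨α.base.obj p.base, α.onObj p.pt⟩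
  map m := ⟨α.base.map m.base, α.onElt m.elt, (α.s_onElt _).trans (congrArg α.onObj m.s_elt),
    (α.t_onElt _).trans (congrArg α.onObj m.t_elt)⟩
  map_id _ := Total.Hom.ext' (α.base.map_id _)
    ((heq_of_eq (α.onElt_sec _ _)).trans (sec_congr (α.base.map_id _) rfl))
  map_comp _ _ := Total.Hom.ext' (α.base.map_comp _ _) (α.onElt_mul _ _ _)

/-- The morphism of total lenses. -/
def totalMap : DeltaLens.Hom P.totalLens Q.totalLens where
  top := α.totalFunctor
  base := α.base
  comm := rfl
  obj_liftObj p y w := congrArg (Total.mk (α.base.obj y)) ((α.t_onElt _).symm.trans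
    ((congrArg (Q.bimod (α.base.map w)).loose.t (α.onElt_sec w p.pt)).trans
      (t_sec_congr (Category.id_comp _).symm rfl)))
  map_lift _ _ _ := Total.comp_eqToHom_eq _ _ _ (Category.id_comp _).symm
    ((heq_of_eq (α.onElt_sec _ _)).trans (sec_congr (Category.id_comp _).symm rfl))

end Hom

end

end Idx

/-! ### Inverses of cells, monad morphisms and tight transformations. -/

lemma CategoryTheory.comp_inverse_swap {C : Type*} [Category* C] {a b c d : C} {m : a ⟶ b}
    {f : b ⟶ d} {f' : d ⟶ b} {g : a ⟶ c} {g' : c ⟶ a} {n : c ⟶ d} (h : m ≫ f = g ≫ n)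
    (hf : f ≫ f' = 𝟙 b) (hg : g' ≫ g = 𝟙 c) : n ≫ f' = g' ≫ m := by
  rw [← Category.comp_id (g' ≫ m), ← hf, Category.assoc, reassoc_of% h, reassoc_of% hg]

open DoubleCategory

section

variable {X : DoubleCategory.{u₁, v₁, u₂, v₂}}

/-- By interchange. Inverse cells are expressed through `tot`, in the category of loose morphisms
and cells, because `f ≫ f'` and `𝟙 A` give different cell types. -/
lemma DoubleCategory.tot_hcomp_inv {A B C A' B' C' : X.Obj} {f : A ⟶ A'} {g : B ⟶ B'} {h : C ⟶ C'}
    {f' : A' ⟶ A} {g' : B' ⟶ B} {h' : C' ⟶ C}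
    {p : X.Loose A B} {q : X.Loose B C} {p' : X.Loose A' B'} {q' : X.Loose B' C'}
    {α : X.Cell f g p p'} {α' : X.Cell f' g' p' p} {β : X.Cell g h q q'} {β' : X.Cell g' h' q' q}
    (hα : tot α ≫ tot α' = 𝟙 _) (hβ : tot β ≫ tot β' = 𝟙 _) :
    tot (X.hcomp α β) ≫ tot (X.hcomp α' β') = 𝟙 _ := by
  rw [← LaxDoubleFunctor.tot_hcomp_comp α α' β β' (γ := X.cellId p) (δ := X.cellId q) hα.symm
    hβ.symm, X.hcomp_id, tot_id]

lemma DoubleCategory.tot_unitCell_inv {A B : X.Obj} {f : A ⟶ B} {g : B ⟶ A} (h : f ≫ g = 𝟙 A) :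
    tot (X.unitCell f) ≫ tot (X.unitCell g) = 𝟙 _ := by
  rw [← tot_comp _ _ rfl rfl, ← X.unitCell_comp, h, X.unitCell_id, tot_id]

/-- The inverse of a monad morphism with invertible cell. -/
abbrev LooseMonad.Hom.inv {M N : LooseMonad X} (f : LooseMonad.Hom M N) (i : N.obj ⟶ M.obj)
    (c : X.Cell i i N.loose M.loose) (h' : i ≫ f.tight = 𝟙 _)
    (hc : tot f.cell ≫ tot c = 𝟙 _) (hc' : tot c ≫ tot f.cell = 𝟙 _) : LooseMonad.Hom N M where
  tight := i
  cell := c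
  map_mul := by
    apply tot_injective
    have h₁ := congrArg tot f.map_mul
    simp only [tot_comp] at h₁ ⊢
    -- Compatibility is a commutative square with invertible sides, so the inverse sides also form
    -- one; the remaining laws for inverses follow the same pattern.
    exact comp_inverse_swap h₁ hc (tot_hcomp_inv hc' hc')
  map_one := by
    apply tot_injective
    have h₁ := congrArg tot f.map_one
    simp only [tot_comp] at h₁ ⊢
    exact comp_inverse_swap h₁ hc (tot_unitCell_inv h')

/-- The inverse of an invertible cell of bimodules. -/
abbrev Bimodule.Cell.inv {M N M' N' : LooseMonad X} {f : M ⟶ M'} {g : N ⟶ N'} {f' : M' ⟶ M}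
    {g' : N' ⟶ N} {p : Bimodule M N} {q : Bimodule M' N'} (α : Bimodule.Cell f g p q)
    (c : X.Cell f'.tight g'.tight q.loose p.loose) (hc : tot α.cell ≫ tot c = 𝟙 _)
    (hc' : tot c ≫ tot α.cell = 𝟙 _) (hf : tot f'.cell ≫ tot f.cell = 𝟙 _)
    (hg : tot g'.cell ≫ tot g.cell = 𝟙 _) : Bimodule.Cell f' g' q p where
  cell := c
  map_lact := by
    apply tot_injective
    have h₁ := congrArg tot α.map_lact
    simp only [tot_comp] at h₁ ⊢
    exact comp_inverse_swap h₁ hc (tot_hcomp_inv hf hc')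
  map_ract := by
    apply tot_injective
    have h₁ := congrArg tot α.map_ract
    simp only [tot_comp] at h₁ ⊢
    exact comp_inverse_swap h₁ hc (tot_hcomp_inv hc' hg)

end

section

variable {X : DoubleCategory.{u₁, v₁, u₂, v₂}} {Y : DoubleCategory.{u₃, v₃, u₄, v₄}}

/-- The inverse of a tight transformation with invertible components. -/
abbrev TightTrans.inv {F G : LaxDoubleFunctor X Y} (θ : TightTrans F G)
    (i : ∀ A, G.tight.obj A ⟶ F.tight.obj A) (hi : ∀ A, θ.app.app A ≫ i A = 𝟙 _)
    (hi' : ∀ A, i A ≫ θ.app.app A = 𝟙 _)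
    (c : ∀ {A B : X.Obj} (p : X.Loose A B), Y.Cell (i A) (i B) (G.loose p) (F.loose p))
    (hc : ∀ {A B : X.Obj} (p : X.Loose A B), tot (θ.cell p) ≫ tot (c p) = 𝟙 _)
    (hc' : ∀ {A B : X.Obj} (p : X.Loose A B), tot (c p) ≫ tot (θ.cell p) = 𝟙 _) :
    TightTrans G F where
  app :=
    { app := i
      naturality := fun A B f => comp_inverse_swap (θ.app.naturality f) (hi B) (hi' A) }
  cell := c
  naturality := fun {A B C D f g p q} α => by
    apply tot_injective
    have h := congrArg tot (θ.naturality α)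
    rw [tot_comp, tot_comp] at h ⊢
    exact comp_inverse_swap h (hc q) (hc' p)
  unit := fun A => by
    apply tot_injective
    have h := congrArg tot (θ.unit A)
    rw [tot_comp, tot_comp] at h ⊢
    exact comp_inverse_swap h (hc _) (tot_unitCell_inv (hi' A))
  mult := fun p q => by
    apply tot_injective
    have h := congrArg tot (θ.mult p q)
    rw [tot_comp, tot_comp] at h ⊢
    exact comp_inverse_swap h (hc _) (tot_hcomp_inv (hc' p) (hc' q))

namespace Idx

variable {B : Cat.{u, u}} {F G : LaxDoubleFunctor (Lo B) X}

/-- A tight transformation as a morphism of indexed categories over the identity. -/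
abbrev homOfTrans (θ : TightTrans F G) : Idx.Hom (X := X) ⟨B, F⟩ ⟨B, G⟩ where
  base := 𝟭 B
  -- The codomain has to be `(Lo.map (𝟭 B)).comp G`, whose comparison cells carry an extra image
  -- under `G` of a cell of `Lo`. By `Lo.tot_eq` that image is an identity, and it is absorbed in
  -- each axiom.
  trans :=
    { app :=
        { app := θ.app.app
          naturality := fun A _ f => (θ.app.naturality f).trans
            (congrArg (θ.app.app A ≫ G.tight.map ·) (Subsingleton.elim _ _)) }
      cell := θ.cell
      naturality := fun {_ _ _ _ _ _ p _} α => by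
        apply tot_injective
        have h := congrArg tot (θ.naturality α)
        rw [tot_comp, tot_comp] at h
        refine (tot_comp _ _ _ _).trans (h.trans (Eq.trans ?_ (tot_comp _ _ _ _).symm))
        exact congrArg (tot (θ.cell p) ≫ ·) (G.tot_cell_congr (Lo.tot_eq _ _))
      unit := fun A => by
        apply tot_injective
        have h := congrArg tot (θ.unit A)
        rw [tot_comp, tot_comp] at h
        refine (tot_comp _ _ _ _).trans (h.trans (Eq.trans ?_ (tot_comp _ _ _ _).symm))
        refine congrArg (tot (X.unitCell (θ.app.app A)) ≫ ·) (Eq.trans ?_ (tot_comp _ _ _ _).symm)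
        refine (Category.comp_id _).symm.trans (congrArg (tot (G.unit A) ≫ ·) ?_)
        exact ((G.tot_cell_congr (Lo.tot_eq _ _)).trans (G.tot_cell_id _)).symm
      mult := fun p q => by
        apply tot_injective
        have h := congrArg tot (θ.mult p q)
        rw [tot_comp, tot_comp] at h
        refine (tot_comp _ _ _ _).trans (h.trans (Eq.trans ?_ (tot_comp _ _ _ _).symm))
        refine congrArg (tot (X.hcomp (θ.cell p) (θ.cell q)) ≫ ·)
          (Eq.trans ?_ (tot_comp _ _ _ _).symm)
        refine (Category.comp_id _).symm.trans (congrArg (tot (G.mult p q) ≫ ·) ?_)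
        exact ((G.tot_cell_congr (Lo.tot_eq _ _)).trans (G.tot_cell_id _)).symm }

/-- Mutually inverse tight transformations give an isomorphism of indexed categories. -/
abbrev isoOfTrans (θ : TightTrans F G) (τ : TightTrans G F)
    (h : ∀ A, θ.app.app A ≫ τ.app.app A = 𝟙 _) (h' : ∀ A, τ.app.app A ≫ θ.app.app A = 𝟙 _)
    (hc : ∀ {a b : (Lo B).Obj} (p : (Lo B).Loose a b), tot (θ.cell p) ≫ tot (τ.cell p) = 𝟙 _)
    (hc' : ∀ {a b : (Lo B).Obj} (p : (Lo B).Loose a b), tot (τ.cell p) ≫ tot (θ.cell p) = 𝟙 _) :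
    (⟨B, F⟩ : Idx X) ≅ ⟨B, G⟩ where
  hom := homOfTrans θ
  inv := homOfTrans τ
  hom_inv_id := congrArg (Hom.mk (P := ⟨B, F⟩) (Q := ⟨B, F⟩) (𝟭 B))
    (TightTrans.ext_tot h fun p => (tot_comp _ _ _ _).trans (hc p))
  inv_hom_id := congrArg (Hom.mk (P := ⟨B, G⟩) (Q := ⟨B, G⟩) (𝟭 B))
    (TightTrans.ext_tot h' fun p => (tot_comp _ _ _ _).trans (hc' p))

end Idx

end

/-! ### Bijective cells in `SMult` and `Mod(SMult)` are invertible. -/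

lemma SplitMultFun.tot_ext {A B C D : Type u} {f f' : A ⟶ C} {g g' : B ⟶ D} {p : SplitMultFun A B}
    {q : SplitMultFun C D} {α : SplitMultFun.Cell f g p q} {β : SplitMultFun.Cell f' g' p q}
    (hf : f = f') (hg : g = g') (h : ∀ x, α.map x = β.map x) :
    tot (X := SMult) α = tot (X := SMult) β := by
  subst hf hg
  exact congrArg _ (SplitMultFun.Cell.ext (funext h))

lemma ModSMult.tot_ext {M N M' N' : LooseMonad SMult.{u}} {f f' : M ⟶ M'} {g g' : N ⟶ N'}
    {p : Bimodule M N} {q : Bimodule M' N'} {α : Bimodule.Cell f g p q}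
    {β : Bimodule.Cell f' g' p q} (hf : f = f') (hg : g = g')
    (h : ∀ x, α.cell.map x = β.cell.map x) :
    tot (X := ModSMult) α = tot (X := ModSMult) β := by
  subst hf hg
  exact congrArg _ (Bimodule.Cell.ext (SplitMultFun.Cell.ext (funext h)))

/-- The inverse of a bijective function, as a morphism of types. -/
noncomputable abbrev bijInv {A B : Type u} (f : A ⟶ B) (hf : Function.Bijective f) : B ⟶ A :=
  ↾(Equiv.ofBijective f hf).symm

lemma comp_bijInv {A B : Type u} (f : A ⟶ B) (hf : Function.Bijective f) :
    f ≫ bijInv f hf = 𝟙 A := by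
  ext x
  exact (Equiv.ofBijective f hf).symm_apply_apply x

lemma bijInv_comp {A B : Type u} (f : A ⟶ B) (hf : Function.Bijective f) :
    bijInv f hf ≫ f = 𝟙 B := by
  ext x
  exact (Equiv.ofBijective f hf).apply_symm_apply x

namespace SplitMultFun.Cell

variable {A B C D : Type u} {f : A ⟶ C} {g : B ⟶ D} {p : SplitMultFun A B} {q : SplitMultFun C D}
  (c : SplitMultFun.Cell f g p q) (hf : Function.Bijective f) (hg : Function.Bijective g)
  (hc : Function.Bijective c.map)

/-- The inverse of a bijective cell with bijective sides. -/
noncomputable abbrev inv : SplitMultFun.Cell (bijInv f hf) (bijInv g hg) q p where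
  map := (Equiv.ofBijective c.map hc).symm
  s_map y := by
    obtain ⟨x, rfl⟩ := hc.2 y
    rw [c.s_map]
    exact (congrArg p.s ((Equiv.ofBijective c.map hc).symm_apply_apply x)).trans
      ((Equiv.ofBijective f hf).symm_apply_apply _).symm
  t_map y := by
    obtain ⟨x, rfl⟩ := hc.2 y
    rw [c.t_map]
    exact (congrArg p.t ((Equiv.ofBijective c.map hc).symm_apply_apply x)).trans
      ((Equiv.ofBijective g hg).symm_apply_apply _).symm
  map_σ a := by
    obtain ⟨a, rfl⟩ := hf.2 a
    rw [← c.map_σ]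
    exact ((Equiv.ofBijective c.map hc).symm_apply_apply _).trans
      (congrArg p.σ ((Equiv.ofBijective f hf).symm_apply_apply a)).symm

lemma tot_comp_inv : tot (X := SMult) c ≫ tot (X := SMult) (c.inv hf hg hc) = 𝟙 _ := by
  rw [← tot_comp (X := SMult) _ _ (comp_bijInv f hf) (comp_bijInv g hg)]
  exact tot_ext rfl rfl (Equiv.ofBijective c.map hc).symm_apply_apply

lemma tot_inv_comp : tot (X := SMult) (c.inv hf hg hc) ≫ tot (X := SMult) c = 𝟙 _ := by
  rw [← tot_comp (X := SMult) _ _ (bijInv_comp f hf) (bijInv_comp g hg)]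
  exact tot_ext rfl rfl (Equiv.ofBijective c.map hc).apply_symm_apply

end SplitMultFun.Cell

namespace ModSMult

section

variable {M N : LooseMonad SMult.{u}}

/-- The inverse of a bijective monad morphism. -/
noncomputable abbrev homInv (f : M ⟶ N) (h : Function.Bijective f.tight)
    (h' : Function.Bijective f.cell.map) : N ⟶ M :=
  LooseMonad.Hom.inv f (bijInv f.tight h) (f.cell.inv h h h') (bijInv_comp _ _)
    (f.cell.tot_comp_inv h h h') (f.cell.tot_inv_comp h h h')

lemma comp_homInv (f : M ⟶ N) (h : Function.Bijective f.tight)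
    (h' : Function.Bijective f.cell.map) : f ≫ homInv f h h' = 𝟙 M :=
  LooseMonad.Hom.ext_tot ((tot_comp _ _ rfl rfl).trans (f.cell.tot_comp_inv h h h'))

lemma homInv_comp (f : M ⟶ N) (h : Function.Bijective f.tight)
    (h' : Function.Bijective f.cell.map) : homInv f h h' ≫ f = 𝟙 N :=
  LooseMonad.Hom.ext_tot ((tot_comp _ _ rfl rfl).trans (f.cell.tot_inv_comp h h h'))

end

/-- A bijective tight transformation is invertible. -/
noncomputable def isoOfBijective {B : Cat.{u, u}}
    {F G : LaxDoubleFunctor (Lo B) ModSMult.{u}} (θ : TightTrans F G)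
    (h₁ : ∀ A, Function.Bijective (θ.app.app A).tight)
    (h₂ : ∀ A, Function.Bijective (θ.app.app A).cell.map)
    (h₃ : ∀ {a b : (Lo B).Obj} (p : (Lo B).Loose a b), Function.Bijective (θ.cell p).cell.map) :
    (⟨B, F⟩ : Idx ModSMult) ≅ ⟨B, G⟩ :=
  have hi A := comp_homInv (θ.app.app A) (h₁ A) (h₂ A)
  have hi' A := homInv_comp (θ.app.app A) (h₁ A) (h₂ A)
  let c {a b : (Lo B).Obj} (p : (Lo B).Loose a b) :
      ModSMult.Cell (homInv (θ.app.app a) (h₁ a) (h₂ a)) (homInv (θ.app.app b) (h₁ b) (h₂ b))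
        (G.loose p) (F.loose p) :=
    Bimodule.Cell.inv (θ.cell p) ((θ.cell p).cell.inv (h₁ a) (h₁ b) (h₃ p))
      ((θ.cell p).cell.tot_comp_inv _ _ _) ((θ.cell p).cell.tot_inv_comp _ _ _)
      ((θ.app.app a).cell.tot_inv_comp _ _ _) ((θ.app.app b).cell.tot_inv_comp _ _ _)
  have hc {a b : (Lo B).Obj} (p : (Lo B).Loose a b) : tot (θ.cell p) ≫ tot (c p) = 𝟙 _ :=
    (tot_comp _ _ (hi a) (hi b)).symm.trans
      (tot_ext rfl rfl (Equiv.ofBijective _ (h₃ p)).symm_apply_apply)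
  have hc' {a b : (Lo B).Obj} (p : (Lo B).Loose a b) : tot (c p) ≫ tot (θ.cell p) = 𝟙 _ :=
    (tot_comp _ _ (hi' a) (hi' b)).symm.trans
      (tot_ext rfl rfl (Equiv.ofBijective _ (h₃ p)).apply_symm_apply)
  Idx.isoOfTrans θ (θ.inv _ hi hi' c hc hc') hi hi' hc hc'

end ModSMult

/-! ### A lax double functor compared with the fibres of its total lens. -/

namespace Idx

section

variable {P : Idx.{u + 1, u, u + 1, u, u} ModSMult.{u}} {x y z : P.base}

/-- The unit comparison is a bimodule cell, hence commutes with left multiplication, and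
`ofFibre_mul` rewrites that action as `mul`. This makes `unitHom` multiplicative. -/
lemma ofFibre_fibre_mul (m n : (P.fibre x).loose.apex)
    (h : (P.fibre x).loose.t m = (P.fibre x).loose.s n) :
    HEq (mul (ofFibre m) (ofFibre n) ((t_ofFibre m).trans (h.trans (s_ofFibre n).symm)))
      (ofFibre ((P.fibre x).mul.map ⟨(m, n), h⟩)) :=
  (ofFibre_mul m (ofFibre n) (h.trans (s_ofFibre n).symm)).trans (heq_of_eq
    (congrFun (congrArg SplitMultFun.Cell.map (P.fib.unit ⟨x⟩).map_lact) ⟨(m, n), h⟩).symm)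

/-- An object of a fibre as an object of the total category. -/
abbrev toFibre {x : P.base} (a : (P.fibre x).obj) : P.totalLens.Fibre x := ⟨⟨x, a⟩, rfl⟩

lemma toFibre_injective {x : P.base} {a b : (P.fibre x).obj} (h : toFibre a = toFibre b) :
    a = b := by
  have h' : (⟨x, a⟩ : Total P) = ⟨x, b⟩ := congrArg Subtype.val h
  simpa using h'

/-- An element over `w` as a morphism of the total category over `w`. -/
abbrev toOver {w : x ⟶ y} (e : P.Elt w) {a : (P.fibre x).obj} {b : (P.fibre y).obj}
    (ha : (P.bimod w).loose.s e = a) (hb : (P.bimod w).loose.t e = b) : P.totalLens.OverHom w where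
  src := toFibre a
  tgt := toFibre b
  hom := ⟨w, e, ha, hb⟩
  fac := ((Category.id_comp _).trans (Category.comp_id w)).symm

lemma toOver_congr {w : x ⟶ y} {e e' : P.Elt w} (h : e = e') {a a' : (P.fibre x).obj}
    {b b' : (P.fibre y).obj} (ha : (P.bimod w).loose.s e = a) (hb : (P.bimod w).loose.t e = b)
    (ha' : (P.bimod w).loose.s e' = a') (hb' : (P.bimod w).loose.t e' = b') :
    toOver e ha hb = toOver e' ha' hb' := by
  subst h ha hb ha' hb'
  rfl

lemma cast_toOver {w v : x ⟶ y} (h : w ≫ eqToHom rfl = eqToHom rfl ≫ v) {e : P.Elt w}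
    {e' : P.Elt v} (he : HEq e e') {a a' : (P.fibre x).obj}
    {b b' : (P.fibre y).obj} (ha : (P.bimod w).loose.s e = a) (hb : (P.bimod w).loose.t e = b)
    (ha' : (P.bimod v).loose.s e' = a') (hb' : (P.bimod v).loose.t e' = b') :
    DeltaLens.OverHom.cast (L := P.totalLens) rfl rfl h (toOver e ha hb) = toOver e' ha' hb' := by
  obtain rfl : w = v := by simpa using h
  obtain rfl := eq_of_heq he
  subst ha hb ha' hb'
  rfl

lemma comp_toOver {w : x ⟶ y} {v : y ⟶ z} {r : x ⟶ z} {e : P.Elt w} {e' : P.Elt v} {d : P.Elt r}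
    {a a' : (P.fibre x).obj} {b b' : (P.fibre y).obj} {c c' : (P.fibre z).obj}
    (ha : (P.bimod w).loose.s e = a) (hb : (P.bimod w).loose.t e = b)
    (hb' : (P.bimod v).loose.s e' = b') (hc : (P.bimod v).loose.t e' = c)
    (ha' : (P.bimod r).loose.s d = a') (hc' : (P.bimod r).loose.t d = c')
    (h : toFibre b = toFibre b') (hr : w ≫ v = r) (hd : HEq (mul e e'
      (hb.trans ((toFibre_injective h).trans hb'.symm))) d) :
    DeltaLens.OverHom.comp (toOver e ha hb) (toOver e' hb' hc) h hr = toOver d ha' hc' := by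
  obtain rfl := toFibre_injective h
  subst hr
  obtain rfl := eq_of_heq hd
  obtain rfl : a = a' := ha.symm.trans ((s_mul e e' _).symm.trans ha')
  obtain rfl : c = c' := hc.symm.trans ((t_mul e e' _).symm.trans hc')
  refine DeltaLens.OverHom.ext' rfl rfl ?_
  -- With the endpoints identified, every transport in the goal unfolds to an identity, and the goal
  -- is `key` up to unfolding.
  let m : (⟨x, a⟩ : Total P) ⟶ ⟨y, b⟩ := ⟨w, e, ha, hb⟩
  let n : (⟨y, b⟩ : Total P) ⟶ ⟨z, c⟩ := ⟨v, e', hb', hc⟩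
  have key : (m ≫ 𝟙 _ ≫ n) ≫ 𝟙 _ = 𝟙 _ ≫ m ≫ n := by simp
  exact key

lemma lift_toFibre (w : x ⟶ y) (a : (P.fibre x).obj) :
    DeltaLens.OverHom.lift (L := P.totalLens) w (toFibre a) =
      toOver (P.sec w a) ((P.bimod w).loose.s_σ a) rfl := by
  -- `OverHom.lift` lifts `eqToHom rfl ≫ w` rather than `w`, so the lifted morphism is generalised
  -- to a `v` equal to `w`.
  have key : ∀ (v : x ⟶ y) (_ : v = w)
      (h : P.totalLens.functor.map (P.totalLens.lift ⟨x, a⟩ v) =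
        eqToHom rfl ≫ w ≫ eqToHom rfl),
      (⟨toFibre a, ⟨P.totalLens.liftObj ⟨x, a⟩ v, rfl⟩, P.totalLens.lift ⟨x, a⟩ v, h⟩ :
        P.totalLens.OverHom w) = toOver (P.sec w a) ((P.bimod w).loose.s_σ a) rfl := by
    rintro _ rfl _
    rfl
  exact key _ (Category.id_comp w) _

lemma toOver_injective {w : x ⟶ y} {e e' : P.Elt w} {a a' : (P.fibre x).obj}
    {b b' : (P.fibre y).obj} {ha : (P.bimod w).loose.s e = a} {hb : (P.bimod w).loose.t e = b}
    {ha' : (P.bimod w).loose.s e' = a'} {hb' : (P.bimod w).loose.t e' = b'}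
    (h : toOver e ha hb = toOver e' ha' hb') : e = e' := by
  -- A sigma type records the element with its base morphism and endpoints, so that no transport
  -- along `h` is needed.
  have h' := congrArg (fun m : P.totalLens.OverHom w =>
    (⟨_, _, Total.Hom.base m.hom, Total.Hom.elt m.hom⟩ :
      Σ (x y : P.base) (w : x ⟶ y), P.Elt w)) h
  simpa using h'

lemma exists_toOver {w : x ⟶ y} (m : P.totalLens.OverHom w) :
    ∃ e : P.Elt w, toOver e rfl rfl = m := by
  obtain ⟨⟨⟨x, a⟩, rfl⟩, ⟨⟨y, b⟩, rfl⟩, ⟨v, e, hs, ht⟩, h⟩ := m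
  -- The functor of the total lens is the projection, so `fac` says that the base component of the
  -- morphism is `w`.
  obtain rfl : v = w := h.trans ((Category.id_comp _).trans (Category.comp_id w))
  exact ⟨e, toOver_congr rfl _ _ hs ht⟩

lemma toOver_bijective (w : x ⟶ y) :
    Function.Bijective (fun e : P.Elt w => toOver e rfl rfl) :=
  ⟨fun _ _ h => toOver_injective h, exists_toOver⟩

lemma toFibre_bijective (x : P.base) : Function.Bijective (toFibre (P := P) (x := x)) := by
  refine ⟨fun _ _ => toFibre_injective, ?_⟩
  rintro ⟨⟨x, a⟩, rfl⟩
  exact ⟨a, rfl⟩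

end

section

variable (P : Idx.{u + 1, u, u + 1, u, u} ModSMult.{u}) {x y : P.base}

/-- The comparison of a fibre monad with the fibre of the total lens. -/
abbrev unitHom (x : P.base) : LooseMonad.Hom (P.fibre x) (P.totalLens.fibreMonad x) where
  tight := ↾toFibre
  cell :=
    { map := fun m => toOver (ofFibre m) (s_ofFibre m) (t_ofFibre m)
      s_map := fun _ => rfl
      t_map := fun _ => rfl
      map_σ := fun a => (toOver_congr (ofFibre_σ a) _ _ _ _).trans (lift_toFibre _ _).symm }
  map_mul := SplitMultFun.Cell.ext (by
    refine funext ?_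
    rintro ⟨⟨m, n⟩, h⟩
    exact (comp_toOver _ _ _ _ _ _ (congrArg toFibre h) (Category.id_comp _)
      (ofFibre_fibre_mul m n h)).symm)
  map_one := SplitMultFun.Cell.ext (funext fun a => (toOver_congr
    ((congrArg ofFibre ((P.fibre x).one.map_σ a)).trans (ofFibre_σ a)) _ _ _ _).trans
      (lift_toFibre _ _).symm)

/-- The comparison of the bimodule over `w` with the morphisms of the total lens over `w`. -/
abbrev unitCell (w : x ⟶ y) : Bimodule.Cell (N' := P.totalLens.fibreMonad y) (P.unitHom x)
    (P.unitHom y) (P.bimod w) (P.totalLens.overBimodule w) where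
  cell :=
    { map := fun m => toOver m rfl rfl
      s_map := fun _ => rfl
      t_map := fun _ => rfl
      map_σ := fun a => (toOver_congr rfl _ _ _ _).trans (lift_toFibre w a).symm }
  map_lact := SplitMultFun.Cell.ext (by
    refine funext ?_
    rintro ⟨⟨m, n⟩, h⟩
    exact (comp_toOver _ _ _ _ _ _ (congrArg toFibre h) (Category.id_comp w)
      (ofFibre_mul m n h)).symm)
  map_ract := SplitMultFun.Cell.ext (by
    refine funext ?_
    rintro ⟨⟨m, n⟩, h⟩
    exact (comp_toOver _ _ _ _ _ _ (congrArg toFibre h) (Category.comp_id w)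
      (mul_ofFibre m n h)).symm)

/-- The comparison of a lax double functor with the fibres of its total lens. -/
abbrev unitTrans : TightTrans P.fib P.totalLens.fibreFunctor where
  app :=
    { app := fun x => P.unitHom x.as
      naturality := by
        rintro ⟨a⟩ ⟨b⟩ f
        obtain rfl : a = b := Discrete.eq_of_hom f
        obtain rfl : f = 𝟙 _ := Subsingleton.elim _ _
        refine (congrArg (· ≫ (P.unitHom a : P.fibre a ⟶ P.totalLens.fibreMonad a))
          (P.fib.tight.map_id _)).trans ?_
        refine (@Category.id_comp (LooseMonad SMult) _ _ _ (P.unitHom a)).trans ?_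
        exact (@Category.comp_id (LooseMonad SMult) _ _ _ (P.unitHom a)).symm }
  cell := fun w => P.unitCell w
  naturality := by
    rintro ⟨a⟩ ⟨b⟩ ⟨c⟩ ⟨d⟩ f g p q α
    obtain rfl : a = c := Discrete.eq_of_hom f
    obtain rfl : b = d := Discrete.eq_of_hom g
    refine Bimodule.Cell.ext (SplitMultFun.Cell.ext (funext fun e => ?_))
    -- The image of `α` does not change `e` up to `HEq`, and the cast does not change the morphism
    -- it represents.
    exact (cast_toOver α.down (cell_heq α e).symm _ _ _ _).symm
  unit := fun x => Bimodule.Cell.ext (SplitMultFun.Cell.ext (funext fun e =>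
    toOver_congr rfl _ _ _ _))
  mult := fun p q => Bimodule.Cell.ext (SplitMultFun.Cell.ext (by
    refine funext ?_
    rintro ⟨⟨⟨m, n⟩, h⟩⟩
    exact (comp_toOver _ _ _ _ _ _ (congrArg toFibre h) rfl HEq.rfl).symm))

end

section

variable {P Q : Idx.{u + 1, u, u + 1, u, u} ModSMult.{u}}

/-- The only place where normality of a given functor is used: an identity unit cell makes the
elements over `𝟙 x` the morphisms of the fibre monad. -/
lemma ofFibre_bijective (hP : P.fib.IsNormal) (x : P.base) :
    Function.Bijective (ofFibre (P := P) (x := x)) := by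
  -- The bimodule over the identity must be a variable before its equality with the unit bimodule
  -- can be substituted and the `HEq` of cells turned into an equality.
  have key : ∀ (R : Bimodule (P.fibre x) (P.fibre x)) (c : ModSMult.Glob (Bimodule.unit _) R)
      (_ : R = Bimodule.unit _) (_ : HEq c (ModSMult.cellId (Bimodule.unit (P.fibre x)))),
      Function.Bijective c.cell.map := by
    rintro _ _ rfl h
    rw [eq_of_heq h]
    exact Function.bijective_id
  exact key _ _ (hP ⟨x⟩).1 (hP ⟨x⟩).2

/-- A normal lax double functor is isomorphic to the fibres of its total lens. -/
noncomputable def unitIso (hP : P.fib.IsNormal) : P ≅ P.totalLens.fibres :=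
  ModSMult.isoOfBijective P.unitTrans (fun x => toFibre_bijective x.as)
    (fun x => by
      -- The cell of `unitHom` is the unit comparison followed by the bijection between elements
      -- over `𝟙 x` and morphisms over it.
      have h : (fun m => toOver (ofFibre m) (s_ofFibre m) (t_ofFibre m)) =
          (fun e : P.Elt (𝟙 x.as) => toOver e rfl rfl) ∘ ofFibre :=
        funext fun m => toOver_congr rfl _ _ _ _
      have h' := (toOver_bijective (𝟙 x.as)).comp (ofFibre_bijective hP x.as)
      rwa [← h] at h')
    (fun w => toOver_bijective w)

lemma unitIso_hom (hP : P.fib.IsNormal) : (unitIso hP).hom = homOfTrans P.unitTrans := rfl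

lemma Hom.onElt_ofFibre (α : Hom P Q) {x : P.base} (m : (P.fibre x).loose.apex) :
    HEq (α.onElt (ofFibre m)) (ofFibre ((α.trans.app.app ⟨x⟩).cell.map m)) :=
  (heq_of_eq (congrFun (congrArg (fun c => c.cell.map) (α.trans.unit ⟨x⟩)) m)).trans
    (cell_heq _ _)

lemma Hom.ext_elt {k : P.base ⥤ Q.base} {θ τ : TightTrans P.fib ((Lo.map k).comp Q.fib)}
    (h : ∀ A, θ.app.app A = τ.app.app A)
    (h' : ∀ {a b : P.base} (w : a ⟶ b) (e : P.Elt w),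
      (θ.cell (A := ⟨a⟩) (B := ⟨b⟩) w).cell.map e = (τ.cell (A := ⟨a⟩) (B := ⟨b⟩) w).cell.map e) :
    (⟨k, θ⟩ : Hom P Q) = ⟨k, τ⟩ :=
  congrArg (Hom.mk (P := P) (Q := Q) k)
    (TightTrans.ext_tot h fun {x y} w => ModSMult.tot_ext (h x) (h y) (h' w))

/-- Both composites send `e` to the morphism represented by `α.onElt e`. On the fibre monads this
needs `onElt_ofFibre`, as `α.base.map (𝟙 x)` is only propositionally an identity. -/
lemma unit_naturality (α : Hom P Q) :
    α.comp (homOfTrans Q.unitTrans) =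
      (homOfTrans P.unitTrans).comp (DeltaLens.fibresMap α.totalMap) := by
  have h : ∀ x : P.base, (α.trans.app.app ⟨x⟩ ≫ Q.unitHom (α.base.obj x) : P.fibre x ⟶ _) =
      (P.unitHom x ≫ DeltaLens.fibreHom α.totalMap x : P.fibre x ⟶ _) := fun x =>
    LooseMonad.Hom.ext_tot (SplitMultFun.tot_ext rfl rfl fun m =>
      (cast_toOver (by simp) (α.onElt_ofFibre m) _ _ _ _).symm)
  apply Hom.ext_elt
  · exact fun x => h x.as
  · exact fun w e => toOver_congr rfl _ _ _ _

lemma unitIso_naturality (hP : P.fib.IsNormal) (hQ : Q.fib.IsNormal) (α : P ⟶ Q) :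
    α ≫ (unitIso hQ).hom =
      (unitIso hP).hom ≫ (DeltaLens.fibresMap (Hom.totalMap α) :
        P.totalLens.fibres ⟶ Q.totalLens.fibres) := by
  rw [unitIso_hom, unitIso_hom]
  exact unit_naturality α

end

end Idx

/-! ### A lens compared with the total lens of its fibres. -/

namespace DeltaLens

section

variable (L : DeltaLens.{u})

/-- The functor from the total category of the fibres of a lens to its source. -/
abbrev counitFunctor : Idx.Total L.fibres ⥤ L.source where
  obj p := p.pt.1
  map {p q} m := eqToHom (congrArg Subtype.val m.s_elt.symm) ≫ OverHom.hom m.elt ≫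
    eqToHom (congrArg Subtype.val m.t_elt)
  map_id p := by
    have key : ∀ (l : L.OverHom (𝟙 p.base)) (_ : l = OverHom.id p.pt) (h : p.pt.1 = l.src.1)
        (h' : l.tgt.1 = p.pt.1), eqToHom h ≫ l.hom ≫ eqToHom h' = 𝟙 _ := by
      rintro _ rfl _ _
      simp
    exact key _ (OverHom.lift_id p.pt) _ _
  map_comp m n := by
    have key : ∀ {x y z : L.target} {w : x ⟶ y} {v : y ⟶ z} (m : L.OverHom w) (n : L.OverHom v)
        (h : m.tgt = n.src) {a b c : L.source} (ha : a = m.src.1) (hb : m.tgt.1 = b)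
        (hb' : b = n.src.1) (hc : n.tgt.1 = c),
        eqToHom ha ≫ (OverHom.comp m n h rfl).hom ≫ eqToHom hc =
          (eqToHom ha ≫ m.hom ≫ eqToHom hb) ≫ eqToHom hb' ≫ n.hom ≫ eqToHom hc := by
      intros
      simp
    exact key m.elt n.elt (m.t_elt.trans n.s_elt.symm) _ _ _ _

variable {L}

/-- The base object is the image of the point under the lens, so the point determines everything. -/
lemma total_ext {p q : Idx.Total L.fibres} (h : p.pt.1 = q.pt.1) : p = q := by
  obtain ⟨x, ⟨a, ha⟩⟩ := p
  obtain ⟨y, ⟨b, hb⟩⟩ := q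
  have ha' : L.functor.obj a = x := ha
  have hb' : L.functor.obj b = y := hb
  have h' : a = b := h
  subst ha' hb' h'
  rfl

lemma map_counitFunctor_map {p q : Idx.Total L.fibres} (m : p ⟶ q) :
    L.functor.map (L.counitFunctor.map m) = eqToHom p.pt.2 ≫ m.base ≫ eqToHom q.pt.2.symm := by
  have key : ∀ {x y : L.target} {w : x ⟶ y} (m : L.OverHom w) {a b : L.source} (ha : a = m.src.1)
      (hb : m.tgt.1 = b) (hx : L.functor.obj a = x) (hy : y = L.functor.obj b),
      L.functor.map (eqToHom ha ≫ m.hom ≫ eqToHom hb) = eqToHom hx ≫ w ≫ eqToHom hy := by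
    rintro _ _ _ m _ _ rfl rfl _ _
    simp [m.fac]
  exact key m.elt _ _ _ _

lemma OverHom.heq {x y : L.target} {w v : x ⟶ y} (h : w = v) {m : L.OverHom w} {n : L.OverHom v}
    (hs : m.src.1 = n.src.1) (ht : m.tgt.1 = n.tgt.1)
    (h' : m.hom ≫ eqToHom ht = eqToHom hs ≫ n.hom) : HEq m n := by
  subst h
  exact heq_of_eq (ext' hs ht h')

/-- Applying the lens functor to the image recovers the base morphism, by `map_counitFunctor_map`;
what remains is a morphism with known endpoints. Equations in the total category can thus be checked
in the source of the lens. -/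
lemma counitFunctor_map_injective {p q : Idx.Total L.fibres} {m n : p ⟶ q}
    (h : L.counitFunctor.map m = L.counitFunctor.map n) : m = n := by
  have hb : m.base = n.base := by
    have h' := congrArg L.functor.map h
    rw [map_counitFunctor_map, map_counitFunctor_map] at h'
    have key : ∀ {a b c d : L.target} (h : a = b) (h' : c = d) (m n : b ⟶ c),
        eqToHom h ≫ m ≫ eqToHom h' = eqToHom h ≫ n ≫ eqToHom h' → m = n := by
      rintro _ _ _ _ rfl rfl _ _ e
      simpa using e
    exact key _ _ _ _ h'
  refine Idx.Total.Hom.ext' hb (OverHom.heq hb (congrArg Subtype.val (m.s_elt.trans n.s_elt.symm))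
    (congrArg Subtype.val (m.t_elt.trans n.t_elt.symm)) ?_)
  have key : ∀ {a b c d a' b' : L.source} (k : c ⟶ d) (l : a' ⟶ b') (h₁ : a = c) (h₂ : d = b)
      (h₃ : a = a') (h₄ : b' = b) (h₅ : d = b') (h₆ : c = a'),
      eqToHom h₁ ≫ k ≫ eqToHom h₂ = eqToHom h₃ ≫ l ≫ eqToHom h₄ →
        k ≫ eqToHom h₅ = eqToHom h₆ ≫ l := by
    rintro _ _ _ _ _ _ _ _ rfl rfl rfl rfl _ _ e
    simpa using e
  exact key _ _ _ _ _ _ _ _ h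

variable (L)

/-- The comparison of the total lens of the fibres of a lens with the lens. -/
abbrev counitHom : Hom L.fibres.totalLens L where
  top := L.counitFunctor
  base := 𝟭 _
  comm := by
    refine CategoryTheory.Functor.ext (fun p => p.pt.2.symm) fun p q m => ?_
    refine Eq.trans ?_ (congrArg (fun k => eqToHom _ ≫ k ≫ eqToHom _)
      (map_counitFunctor_map m)).symm
    have key : ∀ {a b c d : L.target} (m : b ⟶ c) (h : b = a) (h' : c = d),
        m = eqToHom h ≫ (eqToHom h.symm ≫ m ≫ eqToHom h') ≫ eqToHom h'.symm := by
      intros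
      simp
    exact key m.base _ _
  -- Lifts in the total lens are the sections of `overSpan`, which are the chosen lifts of `L`.
  obj_liftObj p y w := rfl
  map_lift p y w := by
    have key : ∀ {a b : L.source} (m : a ⟶ b),
        (eqToHom rfl ≫ m ≫ eqToHom rfl) ≫ eqToHom rfl = m := by
      intros
      simp
    exact key _

/-- A morphism of the source as a morphism of the total category of the fibres. -/
abbrev toTotalHom {a b : L.source} (m : a ⟶ b) :
    (⟨L.functor.obj a, ⟨a, rfl⟩⟩ : Idx.Total L.fibres) ⟶ ⟨L.functor.obj b, ⟨b, rfl⟩⟩ :=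
  ⟨L.functor.map m, ⟨⟨a, rfl⟩, ⟨b, rfl⟩, m, by simp⟩, rfl, rfl⟩

variable {L} in
lemma counitFunctor_toTotalHom {a b : L.source} (m : a ⟶ b) :
    L.counitFunctor.map (L.toTotalHom m) = m := by
  have key : eqToHom rfl ≫ m ≫ eqToHom rfl = m := by simp
  exact key

/-- The functor from the source of a lens to the total category of its fibres. -/
abbrev counitInvFunctor : L.source ⥤ Idx.Total L.fibres where
  obj a := ⟨L.functor.obj a, ⟨a, rfl⟩⟩
  map m := L.toTotalHom m
  map_id a := counitFunctor_map_injective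
    ((counitFunctor_toTotalHom _).trans (L.counitFunctor.map_id ⟨L.functor.obj a, ⟨a, rfl⟩⟩).symm)
  map_comp m n := counitFunctor_map_injective (by
    rw [CategoryTheory.Functor.map_comp, counitFunctor_toTotalHom, counitFunctor_toTotalHom,
      counitFunctor_toTotalHom])

/-- The inverse of the comparison of a lens with the total lens of its fibres. -/
abbrev counitInv : Hom L L.fibres.totalLens where
  top := L.counitInvFunctor
  base := 𝟭 _
  comm := rfl
  -- One of the two identities before `w` comes from the square of functors, the other from the
  -- definition of `OverHom.lift`.
  obj_liftObj a b w := total_ext (congrArg (L.liftObj a)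
    (show w = eqToHom rfl ≫ eqToHom rfl ≫ w by simp))
  map_lift a b w := counitFunctor_map_injective (by
    have key₁ : ∀ (F : Idx.Total L.fibres ⥤ L.source) {p q r : Idx.Total L.fibres} (m : p ⟶ q)
        (h : q = r), F.map (m ≫ eqToHom h) = F.map m ≫ eqToHom (congrArg F.obj h) := by
      rintro _ _ _ _ _ rfl
      simp
    refine (key₁ L.counitFunctor _ _).trans ?_
    refine (congrArg (· ≫ eqToHom _) (counitFunctor_toTotalHom _)).trans ?_
    have e : w = eqToHom rfl ≫ eqToHom rfl ≫ w := by simp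
    have key : ∀ (v : L.functor.obj a ⟶ b) (_ : w = v) (h : L.liftObj a w = L.liftObj a v),
        L.lift a w ≫ eqToHom h = eqToHom rfl ≫ L.lift a v ≫ eqToHom rfl := by
      rintro _ rfl _
      simp
    exact key _ e _)

/-- A lens is isomorphic to the total lens of its fibres. -/
abbrev counitIso : L.fibres.totalLens ≅ L where
  hom := L.counitHom
  inv := L.counitInv
  hom_inv_id := by
    refine Hom.ext (CategoryTheory.Functor.ext (fun _ => total_ext rfl) fun p q m => ?_) rfl
    have key : ∀ (F : Idx.Total L.fibres ⥤ L.source) {p q p' q' : Idx.Total L.fibres} (h : p' = p)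
        (h' : q = q') (m : p ⟶ q), F.map (eqToHom h ≫ m ≫ eqToHom h') =
          eqToHom (congrArg F.obj h) ≫ F.map m ≫ eqToHom (congrArg F.obj h') := by
      rintro _ _ _ _ _ rfl rfl _
      simp
    -- After applying the faithful `counitFunctor`, both sides are the image of `m` up to
    -- identities.
    refine counitFunctor_map_injective (Eq.trans ?_ (key L.counitFunctor _ _ m).symm)
    refine (counitFunctor_toTotalHom (L.counitFunctor.map m)).trans (Eq.symm ?_)
    exact (Category.id_comp _).trans (Category.comp_id _)
  inv_hom_id := by
    refine Hom.ext (CategoryTheory.Functor.ext (fun _ => rfl) fun a b m => ?_) rfl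
    refine (counitFunctor_toTotalHom m).trans ?_
    simp
    rfl

end

/-- Both composites apply `H.top` to the underlying object or morphism of the source; they differ
only in whether the transports are inserted before or after. -/
lemma counit_naturality {L L' : DeltaLens.{u}} (H : Hom L L') :
    (Idx.Hom.totalMap (fibresMap H)).comp L'.counitHom = L.counitHom.comp H := by
  refine Hom.ext (CategoryTheory.Functor.ext (fun _ => rfl) ?_) rfl
  rintro p q m
  have key : ∀ {x y : L.target} {w : x ⟶ y} (m : L.OverHom w) {a b : L.source} (ha : a = m.src.1)
      (hb : m.tgt.1 = b), eqToHom (congrArg H.top.obj ha) ≫ H.top.map m.hom ≫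
        eqToHom (congrArg H.top.obj hb) =
      eqToHom rfl ≫ H.top.map (eqToHom ha ≫ m.hom ≫ eqToHom hb) ≫ eqToHom rfl := by
    intros
    simp [eqToHom_map]
  exact key m.elt (congrArg Subtype.val m.s_elt.symm) (congrArg Subtype.val m.t_elt)

end DeltaLens

/-! ### Assembly of the equivalence. -/

/-- The normal lax double functor of the fibres of a lens. -/
def DeltaLens.normalFibres (L : DeltaLens.{u}) : NormalIdx.{u + 1, u, u + 1, u, u} ModSMult.{u} :=
  ⟨L.fibres, L.fibres_isNormal⟩

/-- The action of `DeltaLens.normalFibres` on morphisms. -/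
def DeltaLens.normalFibresMap {L L' : DeltaLens.{u}} (H : L ⟶ L') :
    L.normalFibres ⟶ L'.normalFibres :=
  ObjectProperty.homMk (fibresMap H)

namespace Idx

variable {P Q : NormalIdx.{u + 1, u, u + 1, u, u} ModSMult.{u}}

/-- The total lens of a normal lax double functor. -/
def lens (P : NormalIdx.{u + 1, u, u + 1, u, u} ModSMult.{u}) : DeltaLens.{u} := P.obj.totalLens

/-- The action of `Idx.lens` on morphisms. -/
def lensMap (α : P ⟶ Q) : lens P ⟶ lens Q := Hom.totalMap α.hom

/-- A normal lax double functor is isomorphic to the fibres of its total lens. -/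
noncomputable def lensIso (P : NormalIdx.{u + 1, u, u + 1, u, u} ModSMult.{u}) :
    P ≅ (lens P).normalFibres :=
  ObjectProperty.isoMk _ (unitIso P.property)

lemma lensIso_naturality (α : P ⟶ Q) :
    α ≫ (lensIso Q).hom = (lensIso P).hom ≫ DeltaLens.normalFibresMap (lensMap α) :=
  ObjectProperty.hom_ext _ (unitIso_naturality P.property Q.property α.hom)

end Idx

/-- The functor that sends a delta lens to the normal lax double functor of its fibres. -/
def DeltaLens.toNormalIdx : DeltaLens.{u} ⥤ NormalIdx.{u + 1, u, u + 1, u, u} ModSMult.{u} where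
  obj L := L.normalFibres
  map H := DeltaLens.normalFibresMap H
  map_id _ := ObjectProperty.hom_ext _ (congrArg (Idx.Hom.mk (𝟭 _))
    (TightTrans.ext_tot (fun _ => rfl) (fun _ => rfl)))
  map_comp H K := ObjectProperty.hom_ext _ (fibresMap_comp H K)

/-- The functor that sends a normal lax double functor to its total lens. -/
def Idx.toDeltaLens : NormalIdx.{u + 1, u, u + 1, u, u} ModSMult.{u} ⥤ DeltaLens.{u} where
  obj P := lens P
  map α := lensMap α
  map_id _ := rfl
  map_comp _ _ := rfl

/-- The fibres of the total lens of a normal lax double functor recover it, naturally. -/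
noncomputable def Idx.unitNatIso :
    𝟭 (NormalIdx.{u + 1, u, u + 1, u, u} ModSMult.{u}) ≅
      Idx.toDeltaLens ⋙ DeltaLens.toNormalIdx :=
  NatIso.ofComponents (fun P => lensIso P) fun α => lensIso_naturality α

/-- The total lens of the fibres of a lens recovers it, naturally. -/
noncomputable def DeltaLens.counitNatIso :
    DeltaLens.toNormalIdx ⋙ Idx.toDeltaLens ≅ 𝟭 DeltaLens.{u} :=
  NatIso.ofComponents (fun L => L.counitIso) fun H => DeltaLens.counit_naturality H

/-- The category of delta lenses is equivalent to the category of normal lax double functors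
`Lo B → Mod(SMult)`, `B` a small category. -/
theorem proposition5p10 : Nonempty (DeltaLens.{u} ≌ NormalIdx.{u + 1, u, u + 1, u, u} ModSMult.{u}) :=
  -- No triangle identity has to be checked, since `Equivalence.mk` corrects one of the two
  -- isomorphisms. The names are swapped here: the inverse of `counitNatIso` is the unit, and the
  -- inverse of `unitNatIso` is the counit.
  ⟨CategoryTheory.Equivalence.mk DeltaLens.toNormalIdx Idx.toDeltaLens
    DeltaLens.counitNatIso.symm Idx.unitNatIso.symm⟩
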